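/- **Setting.** For a unit vector $\mathbf u\in\mathbb R^F_+$ and $\alpha\in(0,\pi/2)$ let $\mathcal C(\mathbf u,\alpha)=\{\mathbf x\in\mathbb R^F\setminus\{0\}:\mathbf x^T\mathbf u\ge\|\mathbf x\|_2\cos\alpha\}$. Let $K\ge 1$, $F\ge 2$, $\lambda_1,\dots,\lambda_K>0$, and let $C_k=\mathcal C(\mathbf u_k,\alpha_k)$, $k\in[K]$, be circular cones in $\mathbb R^F$, all contained in the nonnegative orthant, whose angles $\beta_{ij}=\arccos(\mathbf u_i^T\mathbf u_j)$ satisfy $$\min_{i\ne j}\beta_{ij}>\max_{i\ne j}\max\{\alpha_i+3\alpha_j,\,3\alpha_i+\alpha_j\}$$ (no condition if $K=1$). The $N$ columns of $\mathbf V\in\mathbb R_+^{F\times N}$ are generated independently as follows: choose $k\in[K]$ with probability $1/K$; choose $l$ from the exponential distribution with rate $\lambda_k$; independently choose $\beta$ uniformly in $[0,\alpha_k]$ and then a unit vector $\mathbf z$ uniformly from $\{\mathbf x:\|\mathbf x\|_2=1,\ \mathbf x^T\mathbf u_k=\cos\beta\}$; the column is $\sqrt l\,\mathbf z$. **Algorithm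 (cr1-nmf).** Normalize the columns of $\mathbf V$ to unit $\ell_2$ norm. Take an arbitrary normalized column as first centroid $\mathbf z_1$, and for $k=1,\dots,K-1$ let $\mathbf z_{k+1}$ be a normalized column $\mathbf z$ minimizing $\max_{i\le k}\mathbf z_i^T\mathbf z$. Put each index $n$ into a set $\mathscr I_k$ for which $\mathbf z_k^T\mathbf v_n'$ is largest, where $\mathbf v'_n$ is the $n$-th normalized column. For each $k$ let $\mathbf V_k=\mathbf V(:,\mathscr I_k)=\mathbf U_k\boldsymbol\Sigma_k\mathbf X_k^T$ be a singular value decomposition; the $k$-th column of $\mathbf W^*$ is $|\mathbf U_k(:,1)|$, and the $k$-th row of $\mathbf H^*$ equals $\boldsymbol\Sigma_k(1,1)|\mathbf X_k(:,1)|$ on $\mathscr I_k$ and $0$ elsewhere. Ties, the first centroid and the singular value decompositions may be chosen arbitrarily. **Theorem.** Let $f(\alpha)=\frac12-\frac{\sin 2\alpha}{4\alpha}$. There is a constant $c>0$ depending only on $K$ and on $\alpha_k,\lambda_k$ ($k\in[K]$) such that for all $\epsilon\in(0,1)$, $t\ge1$ and $N\ge c(t/\epsilon)^2F$, with probability at least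 $1-6K\exp(-t^2F)$ the algorithm produces output, and every possible output $\mathbf W^*,\mathbf H^*$ is entrywise nonnegative and satisfies $$\left|\frac{\|\mathbf V-\mathbf W^*\mathbf H^*\|_{\mathrm F}}{\|\mathbf V\|_{\mathrm F}}-\sqrt{\frac{\sum_{k=1}^Kf(\alpha_k)/\lambda_k}{\sum_{k=1}^K1/\lambda_k}}\right|\le c\,\epsilon .$$ Consequently, for fixed cones and rates, the relative error of cr1-nmf converges in probability to $\sqrt{\sum_kf(\alpha_k)/\lambda_k\,/\,\sum_k1/\lambda_k}$ as $N\to\infty$. -/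

import Mathlib

open MeasureTheory ProbabilityTheory Filter Topology
open scoped ENNReal Matrix RealInnerProductSpace

noncomputable section

namespace ConeNMF

/-! ### Circular cones -/

/-- The circular cone with basis vector `u` and size angle `α`. -/
def circularCone {F : ℕ} (u : EuclideanSpace ℝ (Fin F)) (α : ℝ) :
    Set (EuclideanSpace ℝ (Fin F)) :=
  {x | x ≠ 0 ∧ Real.cos α ≤ ⟪x, u⟫ / ‖x‖}

/-- The nonnegative orthant of `ℝ^F`. -/
def nonnegOrthant (F : ℕ) : Set (EuclideanSpace ℝ (Fin F)) :=
  {x | ∀ i, 0 ≤ x i}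

/-- The geometric assumption: the smallest angle `β_ij` between two distinct basis vectors exceeds
every `α_p + 3 α_q` and every `3 α_p + α_q` with `p ≠ q`. -/
def GeometricAssumption {F K : ℕ} (u : Fin K → EuclideanSpace ℝ (Fin F)) (α : Fin K → ℝ) : Prop :=
  ∀ i j : Fin K, i ≠ j → ∀ p q : Fin K, p ≠ q →
    max (α p + 3 * α q) (3 * α p + α q) < Real.arccos ⟪u i, u j⟫

/-! ### The generating process -/

/-- The uniform probability measure on the unit sphere of the hyperplane orthogonal to `u`:
the normalized surface measure. -/
def uniformPerpSphere {F : ℕ} (u : EuclideanSpace ℝ (Fin F)) :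
    Measure (Metric.sphere (0 : (ℝ ∙ u)ᗮ) 1) :=
  cond ((volume : Measure (ℝ ∙ u)ᗮ).toSphere) Set.univ

/-- The unit vector at angle `β` from the unit vector `u`, in the direction `y ⟂ u`. For fixed `β`
this parametrizes `{x : ‖x‖ = 1, ⟪x, u⟫ = cos β}`. -/
def rotateFrom {F : ℕ} (u : EuclideanSpace ℝ (Fin F)) (β : ℝ)
    (y : Metric.sphere (0 : (ℝ ∙ u)ᗮ) 1) : EuclideanSpace ℝ (Fin F) :=
  Real.cos β • u + Real.sin β • ((y : (ℝ ∙ u)ᗮ) : EuclideanSpace ℝ (Fin F))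

/-- The entrywise positive part of a vector. -/
def posPart {F : ℕ} (z : EuclideanSpace ℝ (Fin F)) : EuclideanSpace ℝ (Fin F) :=
  WithLp.toLp 2 fun i => max (z i) 0

open Classical in
/-- If `z` is not in the nonnegative orthant, set its negative entries to zero and rescale the
result to a unit vector. -/
def projOrthant {F : ℕ} (z : EuclideanSpace ℝ (Fin F)) : EuclideanSpace ℝ (Fin F) :=
  if z ∈ nonnegOrthant F then z else ‖posPart z‖⁻¹ • posPart z

/-- The law of a data point generated from one cone: the squared length `l` has law `Exp(lam)`,
the angle `β` is uniform on `[0, α]`, the direction `y` is uniform on the unit sphere of `u^⟂`,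
these three are independent, and the data point is `√l • z` where `z` is the (projected) unit
vector determined by `β` and `y`. -/
def coneLaw {F : ℕ} (u : EuclideanSpace ℝ (Fin F)) (α lam : ℝ) :
    Measure (EuclideanSpace ℝ (Fin F)) :=
  Measure.map
    (fun p : ℝ × ℝ × Metric.sphere (0 : (ℝ ∙ u)ᗮ) 1 =>
      √p.1 • projOrthant (rotateFrom u p.2.1 p.2.2))
    ((expMeasure lam).prod ((cond volume (Set.Icc 0 α)).prod (uniformPerpSphere u)))

/-- The law of one column: the cone `k` is sampled with probability `1 / K`. -/
def columnLaw {F K : ℕ} (u : Fin K → EuclideanSpace ℝ (Fin F)) (α lam : Fin K → ℝ) :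
    Measure (EuclideanSpace ℝ (Fin F)) :=
  ∑ k, (K : ℝ≥0∞)⁻¹ • coneLaw (u k) (α k) (lam k)

/-- The law of the `N` columns of the data matrix: they are independent with law `columnLaw`. -/
def dataLaw {F K : ℕ} (N : ℕ) (u : Fin K → EuclideanSpace ℝ (Fin F)) (α lam : Fin K → ℝ) :
    Measure (Fin N → EuclideanSpace ℝ (Fin F)) :=
  Measure.pi fun _ => columnLaw u α lam

/-- The data matrix with columns `v 0, …, v (N - 1)`. -/
def dataMatrix {F N : ℕ} (v : Fin N → EuclideanSpace ℝ (Fin F)) : Matrix (Fin F) (Fin N) ℝ :=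
  Matrix.of fun i n => v n i

/-! ### The algorithm `cr1-nmf` -/

/-- The `n`-th column of `V`, scaled to unit `ℓ₂` norm. -/
def normalizedColumn {F N : ℕ} (V : Matrix (Fin F) (Fin N) ℝ) (n : Fin N) :
    EuclideanSpace ℝ (Fin F) :=
  ‖WithLp.toLp 2 (V.col n)‖⁻¹ • WithLp.toLp 2 (V.col n)

/-- `cen` lists (the column indices of) centroids that the greedy procedure can pick: the first one
is arbitrary, and each later one minimizes, over all normalized columns, the largest inner product
with the centroids picked before it. -/
def IsGreedyCentroids {F N K : ℕ} (V : Matrix (Fin F) (Fin N) ℝ) (cen : Fin K → Fin N) : Prop :=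
  ∀ (k : Fin K) (h : (Finset.Iio k).Nonempty) (n : Fin N),
    (Finset.Iio k).sup' h (fun i => ⟪normalizedColumn V (cen i), normalizedColumn V (cen k)⟫) ≤
      (Finset.Iio k).sup' h (fun i => ⟪normalizedColumn V (cen i), normalizedColumn V n⟫)

/-- `cl` is a cluster assignment that the greedy clustering method can return, with whatever
choice of the first centroid and of minimizers and maximizers in case of ties. The `k`-th index set
is `{n | cl n = k}`. -/
def IsGreedyClustering {F N K : ℕ} (V : Matrix (Fin F) (Fin N) ℝ) (cl : Fin N → Fin K) : Prop :=
  ∃ cen : Fin K → Fin N, IsGreedyCentroids V cen ∧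
    ∀ (n : Fin N) (j : Fin K),
      ⟪normalizedColumn V (cen j), normalizedColumn V n⟫ ≤
        ⟪normalizedColumn V (cen (cl n)), normalizedColumn V n⟫

/-- `A = U Σ Xᵀ` is a singular value decomposition: `U` and `X` are orthogonal and `Σ` is the
rectangular diagonal matrix with diagonal entries `s 0 ≥ s 1 ≥ ⋯ ≥ 0`. -/
def IsSVD {m n : ℕ} (A : Matrix (Fin m) (Fin n) ℝ) (U : Matrix (Fin m) (Fin m) ℝ) (s : ℕ → ℝ)
    (X : Matrix (Fin n) (Fin n) ℝ) : Prop :=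
  U ∈ Matrix.orthogonalGroup (Fin m) ℝ ∧ X ∈ Matrix.orthogonalGroup (Fin n) ℝ ∧
    Antitone s ∧ (∀ p, 0 ≤ s p) ∧
    A = U * (Matrix.of fun (i : Fin m) (j : Fin n) => if (i : ℕ) = (j : ℕ) then s i else 0) * Xᵀ

/-- The `k`-th index set of a cluster assignment. -/
def cluster {N K : ℕ} (cl : Fin N → Fin K) (k : Fin K) : Finset (Fin N) :=
  Finset.univ.filter fun n => cl n = k

/-- The submatrix `V(:, I)`, with the columns in increasing order. -/
def subColumns {F N : ℕ} (V : Matrix (Fin F) (Fin N) ℝ) (I : Finset (Fin N)) :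
    Matrix (Fin F) (Fin I.card) ℝ :=
  V.submatrix id (I.orderEmbOfFin rfl)

/-- `(W, H)` is a possible output of the algorithm `cr1-nmf` on the input `(V, K)`: cluster the
columns greedily; for each cluster take an SVD `U Σ Xᵀ` of the submatrix `V_k` of its columns; the
`k`-th column of `W` is `|U(:,1)|`, and the `k`-th row of `H` is `Σ(1,1) |X(:,1)|` on the `k`-th
index set and zero elsewhere. -/
def IsCr1NMF {F N K : ℕ} (V : Matrix (Fin F) (Fin N) ℝ) (W : Matrix (Fin F) (Fin K) ℝ)
    (H : Matrix (Fin K) (Fin N) ℝ) : Prop :=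
  ∃ cl : Fin N → Fin K, IsGreedyClustering V cl ∧
    ∀ k : Fin K, ∃ (U : Matrix (Fin F) (Fin F) ℝ) (s : ℕ → ℝ)
        (X : Matrix (Fin (cluster cl k).card) (Fin (cluster cl k).card) ℝ),
      IsSVD (subColumns V (cluster cl k)) U s X ∧
      (∀ i : Fin F, W i k = |U i ⟨0, i.pos⟩|) ∧
      (∀ j : Fin (cluster cl k).card,
        H k ((cluster cl k).orderEmbOfFin rfl j) = s 0 * |X j ⟨0, j.pos⟩|) ∧
      (∀ n : Fin N, n ∉ cluster cl k → H k n = 0)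

/-! ### Relative error and its limit -/

open scoped Matrix.Norms.Frobenius in
/-- The relative error `‖V - W H‖_F / ‖V‖_F` (Frobenius norms). -/
def relativeError {F N K : ℕ} (V : Matrix (Fin F) (Fin N) ℝ) (W : Matrix (Fin F) (Fin K) ℝ)
    (H : Matrix (Fin K) (Fin N) ℝ) : ℝ :=
  ‖V - W * H‖ / ‖V‖

/-- Every possible output `(W, H)` of `cr1-nmf` on `(V, K)` is nonnegative with relative error
within `δ` of `r`, and there is at least one output. -/
def Cr1NMFErrorWithin {F N : ℕ} (K : ℕ) (V : Matrix (Fin F) (Fin N) ℝ) (r δ : ℝ) : Prop :=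
  (∃ (W : Matrix (Fin F) (Fin K) ℝ) (H : Matrix (Fin K) (Fin N) ℝ), IsCr1NMF V W H) ∧
    ∀ (W : Matrix (Fin F) (Fin K) ℝ) (H : Matrix (Fin K) (Fin N) ℝ), IsCr1NMF V W H →
      (∀ i k, 0 ≤ W i k) ∧ (∀ k n, 0 ≤ H k n) ∧ |relativeError V W H - r| ≤ δ

/-- `f(α) = 1/2 - sin(2α) / (4α)`. -/
def fAngle (α : ℝ) : ℝ := 1 / 2 - Real.sin (2 * α) / (4 * α)

/-- `√((∑ f(α_k)/λ_k) / (∑ 1/λ_k))`. -/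
def limitError {K : ℕ} (α lam : Fin K → ℝ) : ℝ :=
  √((∑ k, fAngle (α k) / lam k) / ∑ k, 1 / lam k)

end ConeNMF

end

noncomputable section

namespace ConeNMF

/-! ### A Bernstein inequality -/

/-! Geometry, linear algebra and concentration contribute separately.

Geometry: under the angle condition, two points of one cone always make a smaller angle than two
points of different cones, whichever cones are compared (`ConesSeparated.cos_angle_lt`). Once every
cone contains a column, the greedy centroids therefore hit each cone exactly once, and the clusters
are the cones up to a permutation (`ConesSeparated.exists_perm_cluster_eq`).

Linear algebra: for a nonnegative matrix the moduli of the leading singular vectors still give a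
best rank-one approximation (`IsSVD.sum_sub_abs_mul_abs_sq`). The squared error on a cluster is thus
its total squared norm minus the top eigenvalue of `∑ v vᵀ`.

Concentration: the expected `v vᵀ` of one cone has trace `1/λ`, entry `(1 - f(α))/λ` at the axis
`u`, and no block coupling `u` to its orthogonal complement. Since `f(α) < 1/2`, the whole trace of
the complementary block is below the axis entry, so the top eigenvalue is the axis entry and the
residual is `f(α)/λ`. This survives perturbation when only three quantities per cone are controlled:
the axis entry, the trace, and the norm of the coupling vector (`sum_inner_sq_le`). The last is
tested on a `1/2`-net of at most `5 ^ F` unit vectors.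

All test functions are dominated by `‖x‖ ^ 2`, which is exponentially distributed within a cone, so
a Bernstein bound holds with constants independent of `F` and `u`. A union bound over `K * (4 + 5 ^
F)` events costs a factor `exp (O(F))`, which the sample size `N ≥ c (t/ε)² F` absorbs. Stability of
the square root of a quotient then gives the error bound; letting `t` grow like `√N` at fixed `ε`
gives convergence in probability. -/

open Real in
-- Write `exp y = 1 + y + (exp y - 1 - y)`. Since `exp y - 1` lies between `y` and `y * exp y`, the
-- remainder is at most `y * (exp y - 1)`, which is at most `y ^ 2 * exp y` or `y ^ 2` according to
-- the sign of `y`.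
theorem exp_le_one_add_add_sq_mul_exp (y z : ℝ) (h : |y| ≤ z) :
    exp y ≤ 1 + y + z ^ 2 * exp z := by
  have h0 : 0 ≤ z := (abs_nonneg y).trans h
  have h1 : exp y - 1 ≤ y * exp y := by
    have := mul_le_mul_of_nonneg_right (add_one_le_exp (-y)) (exp_pos y).le
    rw [← exp_add, neg_add_cancel, exp_zero] at this
    linarith
  have h2 : y + 1 ≤ exp y := add_one_le_exp y
  have h3 : y ^ 2 ≤ z ^ 2 := sq_le_sq' (by linarith [neg_abs_le y]) ((le_abs_self y).trans h)
  have h4 : exp y ≤ exp z := exp_le_exp.2 ((le_abs_self y).trans h)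
  have h5 : 1 ≤ exp z := one_le_exp h0
  rcases le_total 0 y with hy | hy
  · have : y * (exp y - 1) ≤ z ^ 2 * exp z := calc
      y * (exp y - 1) ≤ y * (y * exp y) := mul_le_mul_of_nonneg_left h1 hy
      _ = y ^ 2 * exp y := by ring
      _ ≤ z ^ 2 * exp z := by gcongr
    linarith
  · have : y * (exp y - 1) ≤ z ^ 2 * exp z := calc
      y * (exp y - 1) ≤ y * y := mul_le_mul_of_nonpos_left (by linarith) hy
      _ = y ^ 2 * 1 := by ring
      _ ≤ z ^ 2 * exp z := by gcongr
    linarith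

/-- The second-order term is integrated through the envelope `Z`, so `C` is the same for every `Y`
dominated by `Z`. The restriction `s ≤ s₀` reflects that only some exponential moments of `Z` need
be finite. -/
theorem integral_exp_le {Ω : Type*} [MeasurableSpace Ω] {μ : Measure Ω} [IsProbabilityMeasure μ]
    {Y Z : Ω → ℝ} {m C s s₀ : ℝ} (hY : Measurable Y) (hYZ : ∀ ω, |Y ω| ≤ Z ω)
    (hint : Integrable (fun ω => Z ω ^ 2 * Real.exp (s₀ * Z ω)) μ)
    (hC : ∫ ω, Z ω ^ 2 * Real.exp (s₀ * Z ω) ∂μ ≤ C)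
    (hYi : Integrable Y μ) (hm : ∫ ω, Y ω ∂μ ≤ m) (hs : 0 ≤ s) (hs₀ : s ≤ s₀) :
    Integrable (fun ω => Real.exp (s * Y ω)) μ ∧
      ∫ ω, Real.exp (s * Y ω) ∂μ ≤ Real.exp (s * m + C * s ^ 2) := by
  have hpt : ∀ ω, Real.exp (s * Y ω) ≤
      1 + s * Y ω + s ^ 2 * (Z ω ^ 2 * Real.exp (s₀ * Z ω)) := by
    intro ω
    have hZ0 : 0 ≤ Z ω := (abs_nonneg _).trans (hYZ ω)
    have h1 := exp_le_one_add_add_sq_mul_exp (s * Y ω) (s * Z ω)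
      (by rw [abs_mul, abs_of_nonneg hs]; gcongr; exact hYZ ω)
    have h2 : (s * Z ω) ^ 2 * Real.exp (s * Z ω) ≤ s ^ 2 * (Z ω ^ 2 * Real.exp (s₀ * Z ω)) := by
      rw [mul_pow, mul_assoc]; gcongr
    linarith
  have hi1 : Integrable (fun ω => 1 + s * Y ω) μ := (integrable_const _).add (hYi.const_mul s)
  have hi2 : Integrable (fun ω => s ^ 2 * (Z ω ^ 2 * Real.exp (s₀ * Z ω))) μ := hint.const_mul _
  have hi : Integrable (fun ω => Real.exp (s * Y ω)) μ := by
    refine (hi1.add hi2).mono' (by fun_prop) (ae_of_all _ fun ω => ?_)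
    rw [Real.norm_eq_abs, abs_of_nonneg (Real.exp_pos _).le]
    exact hpt ω
  refine ⟨hi, ?_⟩
  calc ∫ ω, Real.exp (s * Y ω) ∂μ
      ≤ ∫ ω, (1 + s * Y ω + s ^ 2 * (Z ω ^ 2 * Real.exp (s₀ * Z ω))) ∂μ :=
        integral_mono hi (hi1.add hi2) hpt
    _ = 1 + s * ∫ ω, Y ω ∂μ + s ^ 2 * ∫ ω, Z ω ^ 2 * Real.exp (s₀ * Z ω) ∂μ := by
        rw [integral_add hi1 hi2, integral_add (integrable_const _) (hYi.const_mul s),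
          integral_const_mul, integral_const_mul]
        simp
    _ ≤ 1 + (s * m + C * s ^ 2) := by
        linarith [mul_le_mul_of_nonneg_left hm hs,
          mul_le_mul_of_nonneg_left hC (sq_nonneg s)]
    _ ≤ Real.exp (s * m + C * s ^ 2) := by
        rw [add_comm (1 : ℝ)]; exact Real.add_one_le_exp _

/-- One-sided Bernstein inequality for the sum of `N` independent copies of `Y`. -/
theorem measure_pi_sum_ge_le {Ω : Type*} [MeasurableSpace Ω] {μ : Measure Ω}
    [IsProbabilityMeasure μ]
    {Y Z : Ω → ℝ} {m C s₀ η : ℝ} (N : ℕ) (hY : Measurable Y)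
    (hYZ : ∀ ω, |Y ω| ≤ Z ω)
    (hint : Integrable (fun ω => Z ω ^ 2 * Real.exp (s₀ * Z ω)) μ)
    (hC : ∫ ω, Z ω ^ 2 * Real.exp (s₀ * Z ω) ∂μ ≤ C) (hC0 : 0 < C)
    (hYi : Integrable Y μ) (hm : ∫ ω, Y ω ∂μ ≤ m) (hη : 0 ≤ η) (hs₀ : η ≤ 2 * C * s₀) :
    (Measure.pi fun _ : Fin N => μ) {ω | N * (m + η) < ∑ n, Y (ω n)} ≤
      ENNReal.ofReal (Real.exp (-(N * η ^ 2 / (4 * C)))) := by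
  -- The minimizer of the Chernoff exponent `C * s ^ 2 - s * η`, with value `-η ^ 2 / (4 * C)`; the
  -- hypothesis `hs₀` keeps it in the admissible range.
  set s := η / (2 * C) with hs
  have hs0 : 0 ≤ s := by positivity
  have hss : s ≤ s₀ := by rw [hs, div_le_iff₀ (by positivity)]; linarith
  obtain ⟨hi, hle⟩ := integral_exp_le hY hYZ hint hC hYi hm hs0 hss
  set P := Measure.pi fun _ : Fin N => μ
  have hprod : ∫ ω : Fin N → Ω, ∏ n, Real.exp (s * Y (ω n)) ∂P ≤
      Real.exp (s * m + C * s ^ 2) ^ N := by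
    have := integral_fintype_prod_eq_prod (𝕜 := ℝ) (μ := fun _ : Fin N => μ) (fun _ ω => Real.exp (s * Y ω))
    rw [this]
    simp only [Finset.prod_const, Finset.card_univ, Fintype.card_fin]
    exact pow_le_pow_left₀ (integral_nonneg fun _ => (Real.exp_pos _).le) hle N
  have hpi : Integrable (fun ω : Fin N → Ω => ∏ n, Real.exp (s * Y (ω n))) P :=
    Integrable.fintype_prod (f := fun _ ω => Real.exp (s * Y ω)) fun _ => hi
  have hmk := mul_meas_ge_le_integral_of_nonneg
    (ae_of_all _ fun ω => Finset.prod_nonneg fun n _ => (Real.exp_pos (s * Y (ω n))).le) hpi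
    (Real.exp (s * (N * (m + η))))
  have hsub : {ω : Fin N → Ω | N * (m + η) < ∑ n, Y (ω n)} ⊆
      {ω | Real.exp (s * (N * (m + η))) ≤ ∏ n, Real.exp (s * Y (ω n))} := by
    intro ω hω
    simp only [Set.mem_ofPred_eq] at hω ⊢
    rw [← Real.exp_sum, ← Finset.mul_sum]
    exact Real.exp_le_exp.2 (mul_le_mul_of_nonneg_left hω.le hs0)
  refine (measure_mono hsub).trans ?_
  rw [← ENNReal.ofReal_toReal (measure_ne_top P _)]
  refine ENNReal.ofReal_le_ofReal ?_
  have h1 : Real.exp (s * (N * (m + η))) * (P {ω | Real.exp (s * (N * (m + η))) ≤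
      ∏ n, Real.exp (s * Y (ω n))}).toReal ≤ Real.exp (s * m + C * s ^ 2) ^ N := hmk.trans hprod
  rw [← Real.exp_nat_mul] at h1
  have h2 : -(N * η ^ 2 / (4 * C)) = N * (s * m + C * s ^ 2) - s * (N * (m + η)) := by
    rw [hs]; field_simp; ring
  rw [h2, Real.exp_sub, le_div_iff₀ (Real.exp_pos _), mul_comm]
  exact h1

/-! ### The exponential law -/

/-- The endpoint `0` is a null set, and the open half-line is the domain on which the Gamma
integrals are stated. -/
theorem expMeasure_eq_withDensity {r : ℝ} :
    expMeasure r = (volume.restrict (Set.Ioi 0)).withDensity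
      fun x => ENNReal.ofReal (r * Real.exp (-(r * x))) := by
  have h : expMeasure r = volume.withDensity (exponentialPDF r) := rfl
  have h2 : exponentialPDF r =
      (Set.Ici (0 : ℝ)).indicator fun x => ENNReal.ofReal (r * Real.exp (-(r * x))) := by
    ext x
    by_cases hx : 0 ≤ x
    · rw [exponentialPDF_of_nonneg hx, Set.indicator_of_mem (Set.mem_Ici.2 hx)]
    · rw [exponentialPDF_of_neg (not_le.1 hx), Set.indicator_of_notMem (by simpa using hx)]
  rw [h, h2, withDensity_indicator measurableSet_Ici, restrict_Ioi_eq_restrict_Ici]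

theorem ae_expMeasure_pos {r : ℝ} : ∀ᵐ l ∂expMeasure r, 0 < l := by
  rw [expMeasure_eq_withDensity]
  exact withDensity_absolutelyContinuous _ _ (ae_restrict_mem measurableSet_Ioi)

theorem integrable_expMeasure_iff {r : ℝ} (hr : 0 < r) {g : ℝ → ℝ} :
    Integrable g (expMeasure r) ↔
      IntegrableOn (fun x => r * Real.exp (-(r * x)) * g x) (Set.Ioi 0) := by
  rw [expMeasure_eq_withDensity, integrable_withDensity_iff_integrable_smul' (by fun_prop)
    (ae_of_all _ fun _ => ENNReal.ofReal_lt_top), IntegrableOn]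
  refine integrable_congr (ae_of_all _ fun x => ?_)
  simp only [smul_eq_mul]
  rw [ENNReal.toReal_ofReal (by positivity)]

theorem integral_expMeasure {r : ℝ} (hr : 0 < r) (g : ℝ → ℝ) :
    ∫ x, g x ∂expMeasure r = ∫ x in Set.Ioi 0, r * Real.exp (-(r * x)) * g x := by
  rw [expMeasure_eq_withDensity, integral_withDensity_eq_integral_toReal_smul (by fun_prop)
    (ae_of_all _ fun _ => ENNReal.ofReal_lt_top)]
  refine integral_congr_ae (ae_of_all _ fun x => ?_)
  simp only [smul_eq_mul]
  rw [ENNReal.toReal_ofReal (by positivity)]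

theorem integral_id_expMeasure {r : ℝ} (hr : 0 < r) : ∫ x, x ∂expMeasure r = 1 / r := by
  rw [integral_expMeasure hr]
  have h := Real.integral_rpow_mul_exp_neg_mul_Ioi (a := 2) (r := r) two_pos hr
  have h2 : Real.Gamma 2 = 1 := by
    simp
  rw [h2, mul_one] at h
  have h3 : ∀ x : ℝ, r * Real.exp (-(r * x)) * x =
      r * (x ^ ((2 : ℝ) - 1) * Real.exp (-(r * x))) := by
    intro x; norm_num; ring
  simp_rw [h3]
  rw [integral_const_mul, h]
  norm_num
  field_simp

theorem integrable_pow_mul_exp_expMeasure {r s : ℝ} (hr : 0 < r) (hs : s < r) (n : ℕ) :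
    Integrable (fun x => x ^ n * Real.exp (s * x)) (expMeasure r) := by
  rw [integrable_expMeasure_iff hr]
  have h := integrableOn_rpow_mul_exp_neg_mul_rpow (p := 1) (s := n) (b := r - s)
    (by have : (0:ℝ) ≤ n := n.cast_nonneg
        linarith) one_pos (by linarith)
  refine (h.const_mul r).congr (ae_of_all _ fun x => ?_)
  simp only [Real.rpow_one, Real.rpow_natCast]
  rw [show -(r - s) * x = -(r * x) + s * x by ring, Real.exp_add]
  ring

/-! ### The uniform law of the angle -/

theorem isProbabilityMeasure_cond_Icc {α : ℝ} (hα : 0 < α) :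
    IsProbabilityMeasure (cond (volume : Measure ℝ) (Set.Icc 0 α)) :=
  cond_isProbabilityMeasure_of_finite (by simp [hα]) (by simp)

theorem ae_cond_Icc {α : ℝ} : ∀ᵐ β ∂(cond (volume : Measure ℝ) (Set.Icc 0 α)), β ∈ Set.Icc 0 α :=
  ae_cond_mem measurableSet_Icc

/-- The origin of `f`: the mean of `cos ^ 2` over `[0, α]` is `1/2 + sin (2α) / (4α)`. -/
theorem integral_cos_sq_cond_Icc {α : ℝ} (hα : 0 < α) :
    ∫ β, Real.cos β ^ 2 ∂(cond (volume : Measure ℝ) (Set.Icc 0 α)) = 1 - fAngle α := by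
  rw [ProbabilityTheory.cond, integral_smul_measure, integral_Icc_eq_integral_Ioc,
    ← intervalIntegral.integral_of_le hα.le, integral_cos_sq]
  simp only [Real.volume_Icc, sub_zero, ENNReal.toReal_inv, ENNReal.toReal_ofReal hα.le, fAngle,
    Real.sin_two_mul, Real.cos_zero, Real.sin_zero, smul_eq_mul]
  field_simp
  ring

theorem fAngle_pos {α : ℝ} (hα : 0 < α) : 0 < fAngle α := by
  rw [fAngle, sub_pos, div_lt_iff₀ (by positivity)]
  have := Real.sin_lt (x := 2 * α) (by positivity)
  linarith

/-- This makes the axis share `1 - f(α)` of the squared norm exceed the share `f(α)` of all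
orthogonal directions together, so that the axis is the leading direction in any dimension. -/
theorem fAngle_lt_half {α : ℝ} (hα : 0 < α) (hα2 : α < Real.pi / 2) : fAngle α < 1 / 2 := by
  have := Real.sin_pos_of_pos_of_lt_pi (x := 2 * α) (by positivity) (by linarith)
  rw [fAngle]
  have h : 0 < Real.sin (2 * α) / (4 * α) := by positivity
  linarith

/-! ### The uniform law on the unit sphere of a hyperplane -/

-- The surface measure of `s` is a multiple of the volume of the cone over `s`, and negation carries
-- the cone over `s` to the cone over `-s`.
open scoped Pointwise in
theorem map_neg_toSphere {E : Type*} [NormedAddCommGroup E] [NormedSpace ℝ E] [MeasurableSpace E]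
    [BorelSpace E] (μ : Measure E) [μ.IsNegInvariant] :
    μ.toSphere.map (fun y => -y) = μ.toSphere := by
  have hm : Measurable (fun y : Metric.sphere (0 : E) 1 => -y) := continuous_neg.measurable
  ext s hs
  rw [Measure.map_apply hm hs, Measure.toSphere_apply' _ hs,
    Measure.toSphere_apply' _ (hm hs)]
  congr 1
  rw [← Measure.measure_neg μ (Set.Ioo (0 : ℝ) 1 • (Subtype.val '' s))]
  congr 1
  ext x
  simp only [Set.mem_smul, Set.mem_image, Set.mem_preimage, Set.mem_neg]
  constructor
  · rintro ⟨r, hr, _, ⟨y, hy, rfl⟩, rfl⟩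
    exact ⟨r, hr, _, ⟨-y, hy, rfl⟩, by simp⟩
  · rintro ⟨r, hr, _, ⟨y, hy, rfl⟩, h⟩
    exact ⟨r, hr, _, ⟨-y, by simpa using hy, rfl⟩, by simp [h]⟩

section PerpSphere

variable {F : ℕ} {u : EuclideanSpace ℝ (Fin F)}

/-- This is where `2 ≤ F` matters: for a trivial hyperplane the sphere is empty and conditioning
yields the zero measure. -/
theorem nontrivial_orthogonal_span_singleton (hF : 2 ≤ F) (hu : ‖u‖ = 1) :
    Nontrivial (ℝ ∙ u)ᗮ := by
  have : Fact (Module.finrank ℝ (EuclideanSpace ℝ (Fin F)) = (F - 1) + 1) :=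
    ⟨by rw [finrank_euclideanSpace_fin]; omega⟩
  have h := Submodule.finrank_orthogonal_span_singleton (𝕜 := ℝ) (n := F - 1) (v := u)
    (by rintro rfl; simp at hu)
  exact Module.nontrivial_of_finrank_pos (R := ℝ) (by omega)

theorem isProbabilityMeasure_uniformPerpSphere (hF : 2 ≤ F) (hu : ‖u‖ = 1) :
    IsProbabilityMeasure (uniformPerpSphere u) := by
  have := nontrivial_orthogonal_span_singleton hF hu
  exact cond_isProbabilityMeasure (by
    rw [Ne, Measure.measure_univ_eq_zero]; exact Measure.toSphere_ne_zero volume)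

/-- Invariance under `y ↦ -y` makes the integral equal to its own negative. -/
theorem integral_inner_uniformPerpSphere (v : EuclideanSpace ℝ (Fin F)) :
    ∫ y, ⟪((y : (ℝ ∙ u)ᗮ) : EuclideanSpace ℝ (Fin F)), v⟫ ∂uniformPerpSphere u = 0 := by
  have hm : Measurable (fun y : Metric.sphere (0 : (ℝ ∙ u)ᗮ) 1 => -y) := continuous_neg.measurable
  have h : (uniformPerpSphere u).map (fun y => -y) = uniformPerpSphere u := by
    rw [uniformPerpSphere, ProbabilityTheory.cond, Measure.restrict_univ, Measure.map_smul,
      map_neg_toSphere]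
  have h2 : ∫ y, ⟪((y : (ℝ ∙ u)ᗮ) : EuclideanSpace ℝ (Fin F)), v⟫ ∂uniformPerpSphere u =
      ∫ y, ⟪(((-y : Metric.sphere (0 : (ℝ ∙ u)ᗮ) 1) : (ℝ ∙ u)ᗮ) : EuclideanSpace ℝ (Fin F)), v⟫
        ∂uniformPerpSphere u := by
    conv_lhs => rw [← h]
    rw [integral_map hm.aemeasurable (by fun_prop)]
  simp only [coe_neg_sphere, Submodule.coe_neg, inner_neg_left, integral_neg] at h2
  linarith

end PerpSphere

/-! ### The law of a data point of one cone -/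

section ConeLaw

variable {F : ℕ} {u : EuclideanSpace ℝ (Fin F)} {α lam : ℝ}

theorem inner_orthogonal_sphere (y : Metric.sphere (0 : (ℝ ∙ u)ᗮ) 1) :
    ⟪((y : (ℝ ∙ u)ᗮ) : EuclideanSpace ℝ (Fin F)), u⟫ = 0 := by
  rw [real_inner_comm]
  exact Submodule.mem_orthogonal_singleton_iff_inner_right.1 (y : (ℝ ∙ u)ᗮ).2

theorem norm_orthogonal_sphere (y : Metric.sphere (0 : (ℝ ∙ u)ᗮ) 1) :
    ‖((y : (ℝ ∙ u)ᗮ) : EuclideanSpace ℝ (Fin F))‖ = 1 := by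
  rw [← Submodule.coe_norm]
  exact norm_eq_of_mem_sphere y

theorem inner_rotateFrom (hu : ‖u‖ = 1) (β : ℝ) (y : Metric.sphere (0 : (ℝ ∙ u)ᗮ) 1) :
    ⟪rotateFrom u β y, u⟫ = Real.cos β := by
  simp [rotateFrom, inner_add_left, inner_smul_left, inner_orthogonal_sphere, hu]

theorem norm_rotateFrom (hu : ‖u‖ = 1) (β : ℝ) (y : Metric.sphere (0 : (ℝ ∙ u)ᗮ) 1) :
    ‖rotateFrom u β y‖ = 1 := by
  have h : ‖rotateFrom u β y‖ ^ 2 = 1 := by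
    rw [← real_inner_self_eq_norm_sq]
    nth_rw 2 [rotateFrom]
    have h2 : ⟪rotateFrom u β y, ((y : (ℝ ∙ u)ᗮ) : EuclideanSpace ℝ (Fin F))⟫ = Real.sin β := by
      simp only [rotateFrom, inner_add_left, inner_smul_left]
      rw [real_inner_comm, inner_orthogonal_sphere, real_inner_self_eq_norm_sq,
        norm_orthogonal_sphere]
      simp
    rw [inner_add_right, inner_smul_right, inner_smul_right, inner_rotateFrom hu, h2]
    nlinarith [Real.sin_sq_add_cos_sq β]
  nlinarith [norm_nonneg (rotateFrom u β y)]

theorem rotateFrom_mem_circularCone (hu : ‖u‖ = 1) (hα : α ≤ Real.pi) {β : ℝ}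
    (hβ : β ∈ Set.Icc 0 α) (y : Metric.sphere (0 : (ℝ ∙ u)ᗮ) 1) :
    rotateFrom u β y ∈ circularCone u α := by
  refine ⟨fun h => ?_, ?_⟩
  · have := norm_rotateFrom hu β y
    simp [h] at this
  · rw [inner_rotateFrom hu, norm_rotateFrom hu, div_one]
    exact Real.cos_le_cos_of_nonneg_of_le_pi hβ.1 hα hβ.2

theorem smul_mem_circularCone {x : EuclideanSpace ℝ (Fin F)} (hx : x ∈ circularCone u α) {r : ℝ}
    (hr : 0 < r) : r • x ∈ circularCone u α := by
  refine ⟨smul_ne_zero hr.ne' hx.1, ?_⟩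
  rw [inner_smul_left, norm_smul, Real.norm_of_nonneg hr.le]
  simp only [conj_trivial]
  rw [mul_div_mul_left _ _ hr.ne']
  exact hx.2

theorem measurableSet_circularCone : MeasurableSet (circularCone u α) :=
  (measurableSet_singleton _).compl.inter
    (measurableSet_le (f := fun _ : EuclideanSpace ℝ (Fin F) => Real.cos α)
      (g := fun x => ⟪x, u⟫ / ‖x‖) (by fun_prop) (by fun_prop))

/-- The joint law of squared length, angle and direction. -/
def paramLaw (u : EuclideanSpace ℝ (Fin F)) (α lam : ℝ) :
    Measure (ℝ × ℝ × Metric.sphere (0 : (ℝ ∙ u)ᗮ) 1) :=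
  (expMeasure lam).prod ((cond volume (Set.Icc 0 α)).prod (uniformPerpSphere u))

/-- The data point determined by squared length, angle and direction. -/
def paramPoint (u : EuclideanSpace ℝ (Fin F)) (p : ℝ × ℝ × Metric.sphere (0 : (ℝ ∙ u)ᗮ) 1) :
    EuclideanSpace ℝ (Fin F) :=
  √p.1 • rotateFrom u p.2.1 p.2.2

theorem continuous_paramPoint : Continuous (paramPoint u) := by
  unfold paramPoint rotateFrom
  fun_prop

/-- The assumptions on one cone. -/
structure ConeData (F : ℕ) (u : EuclideanSpace ℝ (Fin F)) (α lam : ℝ) : Prop where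
  two_le : 2 ≤ F
  norm_eq : ‖u‖ = 1
  pos : 0 < α
  lt : α < Real.pi / 2
  rate_pos : 0 < lam
  subset : circularCone u α ⊆ nonnegOrthant F

namespace ConeData

variable (h : ConeData F u α lam)
include h

theorem isProbabilityMeasure_paramLaw : IsProbabilityMeasure (paramLaw u α lam) := by
  have := isProbabilityMeasure_expMeasure h.rate_pos
  have := isProbabilityMeasure_cond_Icc h.pos
  have := isProbabilityMeasure_uniformPerpSphere h.two_le h.norm_eq
  unfold paramLaw
  infer_instance

theorem ae_paramLaw : ∀ᵐ p ∂paramLaw u α lam, 0 < p.1 ∧ p.2.1 ∈ Set.Icc 0 α := by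
  have := isProbabilityMeasure_expMeasure h.rate_pos
  have := isProbabilityMeasure_cond_Icc h.pos
  have := isProbabilityMeasure_uniformPerpSphere h.two_le h.norm_eq
  refine Eventually.and (Measure.quasiMeasurePreserving_fst.ae ae_expMeasure_pos) ?_
  exact Measure.quasiMeasurePreserving_snd.ae (Measure.quasiMeasurePreserving_fst.ae ae_cond_Icc)

/-- The projection to the orthant is almost surely inactive, because the cone already lies in the
orthant. -/
theorem coneLaw_eq_map : coneLaw u α lam = (paramLaw u α lam).map (paramPoint u) := by
  refine Measure.map_congr ?_
  filter_upwards [h.ae_paramLaw] with p hp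
  have hmem := rotateFrom_mem_circularCone h.norm_eq (by linarith [h.lt, Real.pi_pos]) hp.2 p.2.2
  rw [projOrthant, if_pos (h.subset hmem), paramPoint]

theorem isProbabilityMeasure_coneLaw : IsProbabilityMeasure (coneLaw u α lam) := by
  have := h.isProbabilityMeasure_paramLaw
  rw [h.coneLaw_eq_map]
  exact Measure.isProbabilityMeasure_map continuous_paramPoint.aemeasurable

theorem ae_coneLaw : ∀ᵐ x ∂coneLaw u α lam, x ∈ circularCone u α := by
  rw [h.coneLaw_eq_map]
  refine (ae_map_iff continuous_paramPoint.aemeasurable measurableSet_circularCone).2 ?_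
  filter_upwards [h.ae_paramLaw] with p hp
  exact smul_mem_circularCone (rotateFrom_mem_circularCone h.norm_eq
    (by linarith [h.lt, Real.pi_pos]) hp.2 p.2.2) (Real.sqrt_pos.2 hp.1)

/-- Moments of the envelope `‖x‖ ^ 2` thereby become one-dimensional integrals depending on `lam`
alone, which frees all constants from `F` and `u`. -/
theorem map_norm_sq_coneLaw : (coneLaw u α lam).map (fun x => ‖x‖ ^ 2) = expMeasure lam := by
  have := isProbabilityMeasure_cond_Icc h.pos
  have := isProbabilityMeasure_uniformPerpSphere h.two_le h.norm_eq
  have := isProbabilityMeasure_expMeasure h.rate_pos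
  rw [h.coneLaw_eq_map, Measure.map_map (by fun_prop) continuous_paramPoint.measurable]
  have h1 : (fun x : EuclideanSpace ℝ (Fin F) => ‖x‖ ^ 2) ∘ paramPoint u
      =ᵐ[paramLaw u α lam] Prod.fst := by
    filter_upwards [h.ae_paramLaw] with p hp
    simp [paramPoint, norm_smul, norm_rotateFrom h.norm_eq, Real.sq_sqrt hp.1.le]
  rw [Measure.map_congr h1, paramLaw, Measure.map_fst_prod]
  simp

theorem integrable_comp_norm_sq {g : ℝ → ℝ} (hg : Integrable g (expMeasure lam)) :
    Integrable (fun x => g (‖x‖ ^ 2)) (coneLaw u α lam) := by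
  rw [← h.map_norm_sq_coneLaw] at hg
  exact hg.comp_measurable (by fun_prop)

theorem integral_comp_norm_sq {g : ℝ → ℝ} (hg : Integrable g (expMeasure lam)) :
    ∫ x, g (‖x‖ ^ 2) ∂coneLaw u α lam = ∫ l, g l ∂expMeasure lam := by
  rw [← h.map_norm_sq_coneLaw] at hg ⊢
  rw [integral_map (by fun_prop) hg.1]

theorem integrable_of_abs_le {g : EuclideanSpace ℝ (Fin F) → ℝ} (hg : Measurable g)
    (hle : ∀ x, |g x| ≤ ‖x‖ ^ 2) : Integrable g (coneLaw u α lam) := by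
  have h1 := h.integrable_comp_norm_sq (g := fun l => l)
    (by simpa using integrable_pow_mul_exp_expMeasure h.rate_pos h.rate_pos 1)
  exact h1.mono' hg.aestronglyMeasurable (ae_of_all _ hle)

theorem integral_norm_sq : ∫ x, ‖x‖ ^ 2 ∂coneLaw u α lam = 1 / lam := by
  rw [h.integral_comp_norm_sq (g := fun l => l)
    (by simpa using integrable_pow_mul_exp_expMeasure h.rate_pos h.rate_pos 1),
    integral_id_expMeasure h.rate_pos]

theorem integral_inner_sq : ∫ x, ⟪x, u⟫ ^ 2 ∂coneLaw u α lam = (1 - fAngle α) / lam := by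
  have := isProbabilityMeasure_cond_Icc h.pos
  have := isProbabilityMeasure_uniformPerpSphere h.two_le h.norm_eq
  have := isProbabilityMeasure_expMeasure h.rate_pos
  rw [h.coneLaw_eq_map, integral_map continuous_paramPoint.aemeasurable (by fun_prop)]
  have h1 : ∀ᵐ p ∂paramLaw u α lam, ⟪paramPoint u p, u⟫ ^ 2 = p.1 * Real.cos p.2.1 ^ 2 := by
    filter_upwards [h.ae_paramLaw] with p hp
    simp [paramPoint, inner_smul_left, inner_rotateFrom h.norm_eq, mul_pow, Real.sq_sqrt hp.1.le]
  rw [integral_congr_ae h1, paramLaw,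
    integral_prod_mul (fun l : ℝ => l) fun q : ℝ × _ => Real.cos q.1 ^ 2,
    integral_fun_fst (fun β => Real.cos β ^ 2), integral_id_expMeasure h.rate_pos,
    integral_cos_sq_cond_Icc h.pos]
  simp
  ring

/-- The axial part is `√l cos β` and the orthogonal part is `√l sin β` times the direction `y`; by
independence the mean of `y`, which is zero, factors out. Hence `u` is an eigenvector of the second
moment matrix. -/
theorem integral_inner_mul_inner (v : EuclideanSpace ℝ (Fin F)) :
    ∫ x, ⟪x, u⟫ * ⟪x - ⟪x, u⟫ • u, v⟫ ∂coneLaw u α lam = 0 := by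
  have := isProbabilityMeasure_cond_Icc h.pos
  have := isProbabilityMeasure_uniformPerpSphere h.two_le h.norm_eq
  have := isProbabilityMeasure_expMeasure h.rate_pos
  rw [h.coneLaw_eq_map, integral_map continuous_paramPoint.aemeasurable (by fun_prop)]
  have h1 : ∀ᵐ p ∂paramLaw u α lam,
      ⟪paramPoint u p, u⟫ * ⟪paramPoint u p - ⟪paramPoint u p, u⟫ • u, v⟫ =
      p.1 * (Real.cos p.2.1 * Real.sin p.2.1 *
        ⟪((p.2.2 : (ℝ ∙ u)ᗮ) : EuclideanSpace ℝ (Fin F)), v⟫) := by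
    filter_upwards [h.ae_paramLaw] with p hp
    have h2 : ⟪paramPoint u p, u⟫ = √p.1 * Real.cos p.2.1 := by
      simp [paramPoint, inner_smul_left, inner_rotateFrom h.norm_eq]
    have h3 : paramPoint u p - ⟪paramPoint u p, u⟫ • u =
        (√p.1 * Real.sin p.2.1) • ((p.2.2 : (ℝ ∙ u)ᗮ) : EuclideanSpace ℝ (Fin F)) := by
      rw [h2, paramPoint, rotateFrom]
      module
    rw [h3, h2, inner_smul_left]
    simp only [conj_trivial]
    linear_combination Real.cos p.2.1 * Real.sin p.2.1 *
      ⟪((p.2.2 : (ℝ ∙ u)ᗮ) : EuclideanSpace ℝ (Fin F)), v⟫ * Real.mul_self_sqrt hp.1.le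
  rw [integral_congr_ae h1, paramLaw,
    integral_prod_mul (fun l : ℝ => l) fun q : ℝ × Metric.sphere (0 : (ℝ ∙ u)ᗮ) 1 =>
      Real.cos q.1 * Real.sin q.1 * ⟪((q.2 : (ℝ ∙ u)ᗮ) : EuclideanSpace ℝ (Fin F)), v⟫,
    integral_prod_mul (fun β : ℝ => Real.cos β * Real.sin β)
      fun y : Metric.sphere (0 : (ℝ ∙ u)ᗮ) 1 => ⟪((y : (ℝ ∙ u)ᗮ) : EuclideanSpace ℝ (Fin F)), v⟫,
    integral_inner_uniformPerpSphere]
  simp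

end ConeData

end ConeLaw

/-! ### The law of a column -/

section ColumnLaw

variable {F K : ℕ} {u : Fin K → EuclideanSpace ℝ (Fin F)} {α lam : Fin K → ℝ}

theorem isProbabilityMeasure_columnLaw (hK : 1 ≤ K)
    (h : ∀ k, ConeData F (u k) (α k) (lam k)) : IsProbabilityMeasure (columnLaw u α lam) := by
  have := fun k => (h k).isProbabilityMeasure_coneLaw
  constructor
  simp only [columnLaw, Measure.coe_finsetSum, Finset.sum_apply, Measure.smul_apply, measure_univ,
    smul_eq_mul, mul_one, Finset.sum_const, Finset.card_univ, Fintype.card_fin, nsmul_eq_mul]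
  exact ENNReal.mul_inv_cancel (by exact_mod_cast (by omega : K ≠ 0)) (ENNReal.natCast_ne_top K)

theorem ae_columnLaw (h : ∀ k, ConeData F (u k) (α k) (lam k)) :
    ∀ᵐ x ∂columnLaw u α lam, ∃ k, x ∈ circularCone (u k) (α k) := by
  rw [columnLaw, ae_iff, Measure.coe_finsetSum, Finset.sum_apply]
  refine Finset.sum_eq_zero fun k _ => ?_
  rw [Measure.smul_apply, ae_iff.1 ((h k).ae_coneLaw.mono fun x hx => ⟨k, hx⟩), smul_zero]

theorem integrable_columnLaw (hK : 1 ≤ K) {g : EuclideanSpace ℝ (Fin F) → ℝ}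
    (hg : ∀ k, Integrable g (coneLaw (u k) (α k) (lam k))) :
    Integrable g (columnLaw u α lam) := by
  refine integrable_finsetSum_measure.2 fun k _ => (hg k).smul_measure ?_
  exact ENNReal.inv_ne_top.2 (by exact_mod_cast (by omega : K ≠ 0))

theorem integral_columnLaw (hK : 1 ≤ K) {g : EuclideanSpace ℝ (Fin F) → ℝ}
    (hg : ∀ k, Integrable g (coneLaw (u k) (α k) (lam k))) :
    ∫ x, g x ∂columnLaw u α lam = (K : ℝ)⁻¹ * ∑ k, ∫ x, g x ∂coneLaw (u k) (α k) (lam k) := by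
  rw [columnLaw, integral_finsetSum_measure, Finset.mul_sum]
  · refine Finset.sum_congr rfl fun k _ => ?_
    rw [integral_smul_measure]
    simp
  · exact fun k _ => (hg k).smul_measure
      (ENNReal.inv_ne_top.2 (by exact_mod_cast (by omega : K ≠ 0)))

/-- Because the cones are disjoint, the indicator of the `k`-th cone selects the `k`-th component of
the mixture almost surely. -/
theorem integral_indicator_columnLaw (hK : 1 ≤ K) (h : ∀ k, ConeData F (u k) (α k) (lam k))
    (hd : Pairwise fun i j => Disjoint (circularCone (u i) (α i)) (circularCone (u j) (α j)))
    (k : Fin K) {g : EuclideanSpace ℝ (Fin F) → ℝ}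
    (hg : ∀ k, Integrable g (coneLaw (u k) (α k) (lam k))) :
    ∫ x, (circularCone (u k) (α k)).indicator g x ∂columnLaw u α lam =
      (∫ x, g x ∂coneLaw (u k) (α k) (lam k)) / K := by
  rw [integral_columnLaw hK fun k => (hg k).indicator measurableSet_circularCone,
    Finset.sum_eq_single k]
  · rw [div_eq_inv_mul]
    congr 1
    refine integral_congr_ae ?_
    filter_upwards [(h k).ae_coneLaw] with x hx
    rw [Set.indicator_of_mem hx]
  · intro j _ hj
    refine integral_eq_zero_of_ae ?_
    filter_upwards [(h j).ae_coneLaw] with x hx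
    rw [Set.indicator_of_notMem (Set.disjoint_left.1 (hd hj) hx), Pi.zero_apply]
  · simp

end ColumnLaw

/-! ### A net of the unit sphere -/

/-- A `1/2`-separated set of unit vectors with the most elements is a net, since a far point could
be added. Doubled, such a set is `1`-separated in the ball of radius 2, where the volume bound of
the Besicovitch covering theory gives `5 ^ F`. -/
theorem exists_half_net (F : ℕ) : ∃ s : Finset (EuclideanSpace ℝ (Fin F)), s.card ≤ 5 ^ F ∧
    (∀ v ∈ s, ‖v‖ = 1) ∧ ∀ w : EuclideanSpace ℝ (Fin F), ‖w‖ = 1 → ∃ v ∈ s, ‖w - v‖ < 1 / 2 := by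
  classical
  let P : Finset (EuclideanSpace ℝ (Fin F)) → Prop := fun s =>
    (∀ v ∈ s, ‖v‖ = 1) ∧ ∀ v ∈ s, ∀ w ∈ s, v ≠ w → 1 / 2 ≤ ‖v - w‖
  have hP : ∀ s, P s → s.card ≤ 5 ^ F := by
    intro s hs
    have hinj : Function.Injective fun v : EuclideanSpace ℝ (Fin F) => (2 : ℝ) • v :=
      smul_right_injective _ two_ne_zero
    have := Besicovitch.card_le_of_separated (s.image fun v => (2 : ℝ) • v) ?_ ?_
    · rwa [Finset.card_image_of_injective _ hinj, finrank_euclideanSpace_fin] at this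
    · intro c hc
      obtain ⟨v, hv, rfl⟩ := Finset.mem_image.1 hc
      simp [norm_smul, hs.1 v hv]
    · intro c hc d hd hcd
      obtain ⟨v, hv, rfl⟩ := Finset.mem_image.1 hc
      obtain ⟨w, hw, rfl⟩ := Finset.mem_image.1 hd
      have := hs.2 v hv w hw fun h => hcd (by rw [h])
      rw [← smul_sub, norm_smul, Real.norm_two]
      linarith
  obtain ⟨s, hs, hcard⟩ := Nat.findGreatest_spec (P := fun n => ∃ s, P s ∧ s.card = n)
    (Nat.zero_le (5 ^ F)) ⟨∅, by simp [P], rfl⟩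
  refine ⟨s, hP s hs, hs.1, fun w hw => ?_⟩
  by_contra! hfar
  have hws : w ∉ s := fun hmem => by
    have := hfar w hmem
    norm_num at this
  have hins : P (insert w s) := by
    refine ⟨fun v hv => ?_, fun v hv v' hv' hne => ?_⟩
    · rcases Finset.mem_insert.1 hv with rfl | hv
      exacts [hw, hs.1 v hv]
    · rcases Finset.mem_insert.1 hv with h1 | h1 <;> rcases Finset.mem_insert.1 hv' with h2 | h2
      · exact absurd (h1.trans h2.symm) hne
      · rw [h1]; exact hfar v' h2
      · rw [h2, norm_sub_rev]; exact hfar v h1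
      · exact hs.2 v h1 v' h2 hne
  have hle := Nat.le_findGreatest (P := fun n => ∃ s, P s ∧ s.card = n) (hP _ hins) ⟨_, hins, rfl⟩
  rw [← hcard, Finset.card_insert_of_notMem hws] at hle
  omega

section Quadratic

variable {E : Type*} [NormedAddCommGroup E] [InnerProductSpace ℝ E]

/-- Testing `p` against its own direction gives `‖p‖`; moving to the nearby net point loses at most
`‖p‖ / 2`. -/
theorem norm_le_two_mul_of_net {s : Finset E}
    (hs : ∀ w : E, ‖w‖ = 1 → ∃ v ∈ s, ‖w - v‖ < 1 / 2) {p : E} {η : ℝ} (hη : 0 ≤ η)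
    (h : ∀ v ∈ s, ⟪p, v⟫ ≤ η) : ‖p‖ ≤ 2 * η := by
  rcases eq_or_ne p 0 with rfl | hp
  · simpa using hη
  have hp' : ‖p‖ ≠ 0 := norm_ne_zero_iff.2 hp
  obtain ⟨v, hv, hvw⟩ := hs (‖p‖⁻¹ • p) (by rw [norm_smul, norm_inv, norm_norm,
    inv_mul_cancel₀ hp'])
  have h1 : ⟪p, ‖p‖⁻¹ • p⟫ = ‖p‖ := by
    rw [inner_smul_right, real_inner_self_eq_norm_sq]
    field_simp
  have h2 : ⟪p, ‖p‖⁻¹ • p - v⟫ ≤ ‖p‖ * (1 / 2) :=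
    (real_inner_le_norm _ _).trans (mul_le_mul_of_nonneg_left hvw.le (norm_nonneg _))
  rw [inner_sub_right, h1] at h2
  linarith [h v hv]

theorem norm_sub_inner_smul_sq {u : E} (hu : ‖u‖ = 1) (x : E) :
    ‖x - ⟪x, u⟫ • u‖ ^ 2 = ‖x‖ ^ 2 - ⟪x, u⟫ ^ 2 := by
  rw [norm_sub_sq_real, inner_smul_right, norm_smul, hu, Real.norm_eq_abs, mul_one, sq_abs]
  ring

theorem abs_inner_le_norm {u : E} (hu : ‖u‖ = 1) (x : E) : |⟪x, u⟫| ≤ ‖x‖ := by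
  simpa [hu] using abs_real_inner_le_norm x u

theorem abs_inner_mul_inner_le {u v : E} (hu : ‖u‖ = 1) (hv : ‖v‖ = 1) (x : E) :
    |⟪x, u⟫ * ⟪x - ⟪x, u⟫ • u, v⟫| ≤ ‖x‖ ^ 2 := by
  rw [abs_mul, sq]
  have h2 : ‖x - ⟪x, u⟫ • u‖ ≤ ‖x‖ := by
    refine le_of_sq_le_sq ?_ (norm_nonneg x)
    rw [norm_sub_inner_smul_sq hu]
    linarith [sq_nonneg ⟪x, u⟫]
  exact mul_le_mul (abs_inner_le_norm hu x) ((abs_inner_le_norm hv _).trans h2) (abs_nonneg _)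
    (norm_nonneg _)

/-- A bound on the top eigenvalue of `∑ x xᵀ` in terms of its entry at `u`, its trace and the
off-diagonal block. -/
theorem sum_inner_sq_le {ι : Type*} (I : Finset ι) (x : ι → E) {u w : E} (hu : ‖u‖ = 1)
    (hw : ‖w‖ = 1) {M : ℝ} (h1 : ∑ n ∈ I, ⟪x n, u⟫ ^ 2 ≤ M)
    (h2 : ∑ n ∈ I, ‖x n‖ ^ 2 - ∑ n ∈ I, ⟪x n, u⟫ ^ 2 ≤ M) :
    ∑ n ∈ I, ⟪x n, w⟫ ^ 2 ≤ M + 2 * ‖∑ n ∈ I, ⟪x n, u⟫ • (x n - ⟪x n, u⟫ • u)‖ := by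
  set p := ∑ n ∈ I, ⟪x n, u⟫ • (x n - ⟪x n, u⟫ • u)
  set a := ⟪w, u⟫ with ha
  have ha1 : |a| ≤ 1 := (abs_inner_le_norm hu w).trans hw.le
  have hw' : ‖w - a • u‖ ^ 2 = 1 - a ^ 2 := by rw [ha, norm_sub_inner_smul_sq hu, hw]; ring
  -- Split `w` into `a • u` and an orthogonal part of squared norm `1 - a ^ 2`, and apply
  -- Cauchy–Schwarz to the latter. After summation both diagonal blocks are at most `M`, with
  -- weights `a ^ 2` and `1 - a ^ 2` adding up to one.
  have hpt : ∀ n, ⟪x n, w⟫ ^ 2 ≤ a ^ 2 * ⟪x n, u⟫ ^ 2 +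
      2 * a * ⟪⟪x n, u⟫ • (x n - ⟪x n, u⟫ • u), w⟫ +
      (1 - a ^ 2) * (‖x n‖ ^ 2 - ⟪x n, u⟫ ^ 2) := by
    intro n
    set r := x n - ⟪x n, u⟫ • u with hr
    have hru : ⟪r, u⟫ = 0 := by
      rw [hr, inner_sub_left, inner_smul_left, real_inner_self_eq_norm_sq, hu]; simp
    have hrw : ⟪r, w⟫ = ⟪r, w - a • u⟫ := by rw [inner_sub_right, inner_smul_right, hru]; ring
    have hrs : ⟪r, w⟫ ^ 2 ≤ (1 - a ^ 2) * (‖x n‖ ^ 2 - ⟪x n, u⟫ ^ 2) := by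
      rw [hrw, ← hw', ← norm_sub_inner_smul_sq hu, ← hr, mul_comm, ← mul_pow]
      exact sq_le_sq' (by linarith [neg_abs_le ⟪r, w - a • u⟫, abs_real_inner_le_norm r (w - a • u)])
        (real_inner_le_norm _ _)
    have hx : ⟪x n, w⟫ = ⟪x n, u⟫ * a + ⟪r, w⟫ := by
      rw [hr, inner_sub_left, inner_smul_left, ha, real_inner_comm u w]; simp
    rw [hx, inner_smul_left]
    simp only [conj_trivial]
    nlinarith
  have hsum := Finset.sum_le_sum fun n (_ : n ∈ I) => hpt n
  rw [Finset.sum_add_distrib, Finset.sum_add_distrib, ← Finset.mul_sum, ← Finset.mul_sum,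
    ← Finset.mul_sum, ← sum_inner, Finset.sum_sub_distrib] at hsum
  have hp : a * ⟪p, w⟫ ≤ ‖p‖ := by
    refine (le_abs_self _).trans ?_
    rw [abs_mul]
    exact (mul_le_mul ha1 (abs_inner_le_norm hw p) (abs_nonneg _) zero_le_one).trans
      (one_mul _).le
  have ha2 : 0 ≤ 1 - a ^ 2 := by rw [← hw']; positivity
  have h3 := mul_le_mul_of_nonneg_left h1 (sq_nonneg a)
  have h4 := mul_le_mul_of_nonneg_left h2 ha2
  linarith

end Quadratic

/-! ### Concentration of the sample -/

/-- A union bound over the Bernstein events of the family. The bounds hold at every point of an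
explicit measurable set, so later events need not be shown measurable. -/
theorem exists_measurableSet_forall_sum_le {Ω ι : Type*} [MeasurableSpace Ω] [Fintype ι]
    {μ : Measure Ω} [IsProbabilityMeasure μ] {S : Set Ω} (hS : MeasurableSet S)
    (hSμ : ∀ᵐ x ∂μ, x ∈ S) {Y : ι → Ω → ℝ} {Z : Ω → ℝ} {m : ι → ℝ} {C s₀ η : ℝ} (N : ℕ)
    (hY : ∀ i, Measurable (Y i)) (hYZ : ∀ i ω, |Y i ω| ≤ Z ω)
    (hint : Integrable (fun ω => Z ω ^ 2 * Real.exp (s₀ * Z ω)) μ)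
    (hC : ∫ ω, Z ω ^ 2 * Real.exp (s₀ * Z ω) ∂μ ≤ C) (hC0 : 0 < C)
    (hYi : ∀ i, Integrable (Y i) μ) (hm : ∀ i, ∫ ω, Y i ω ∂μ ≤ m i) (hη : 0 ≤ η)
    (hs₀ : η ≤ 2 * C * s₀) :
    ∃ G : Set (Fin N → Ω), MeasurableSet G ∧
      ENNReal.ofReal (1 - Fintype.card ι * Real.exp (-(N * η ^ 2 / (4 * C)))) ≤
        (Measure.pi fun _ => μ) G ∧
      ∀ v ∈ G, (∀ n, v n ∈ S) ∧ ∀ i, ∑ n, Y i (v n) ≤ N * (m i + η) := by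
  set P := Measure.pi fun _ : Fin N => μ
  let B : ι → Set (Fin N → Ω) := fun i => {ω | N * (m i + η) < ∑ n, Y i (ω n)}
  have hBm : ∀ i, MeasurableSet (B i) := fun i =>
    measurableSet_lt measurable_const (Finset.measurable_fun_sum _ fun n _ =>
      (hY i).comp (measurable_pi_apply n))
  let A : Set (Fin N → Ω) := {ω | ∀ n, ω n ∈ S}
  have hAm : MeasurableSet A := by
    have : A = ⋂ n, (fun ω : Fin N → Ω => ω n) ⁻¹' S := by ext; simp [A]
    rw [this]
    exact MeasurableSet.iInter fun n => measurable_pi_apply n hS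
  have hA : P Aᶜ = 0 := by
    refine (ae_all_iff.2 fun n => ?_ : ∀ᵐ ω ∂P, ∀ n, ω n ∈ S)
    exact (Measure.quasiMeasurePreserving_eval (fun _ : Fin N => μ) n).ae hSμ
  have hBP : P (⋃ i, B i) ≤ ENNReal.ofReal (Fintype.card ι *
      Real.exp (-(N * η ^ 2 / (4 * C)))) := by
    refine (measure_iUnion_fintype_le P B).trans ?_
    refine (Finset.sum_le_sum fun i _ => measure_pi_sum_ge_le N (hY i) (hYZ i) hint hC hC0
      (hYi i) (hm i) hη hs₀).trans ?_
    rw [Finset.sum_const, Finset.card_univ, nsmul_eq_mul, ENNReal.ofReal_mul (by positivity),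
      ENNReal.ofReal_natCast]
  have hGm : MeasurableSet (A ∩ (⋃ i, B i)ᶜ) := hAm.inter (MeasurableSet.iUnion hBm).compl
  refine ⟨A ∩ (⋃ i, B i)ᶜ, hGm, ?_, ?_⟩
  · rw [ENNReal.ofReal_sub _ (by positivity), ENNReal.ofReal_one]
    refine tsub_le_iff_right.2 ?_
    rw [← measure_univ (μ := P), ← measure_add_measure_compl hGm]
    gcongr
    rw [Set.compl_inter, compl_compl]
    exact (measure_union_le _ _).trans (by rw [hA, zero_add]; exact hBP)
  · rintro v ⟨hvA, hvB⟩
    refine ⟨hvA, fun i => ?_⟩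
    by_contra! hlt
    exact hvB (Set.mem_iUnion.2 ⟨i, hlt⟩)

section GoodSample

variable {F K N : ℕ} {u : Fin K → EuclideanSpace ℝ (Fin F)} {α lam : Fin K → ℝ}

open Classical in
/-- The indices of the columns that lie in the `k`-th cone. -/
def coneIndices (u : Fin K → EuclideanSpace ℝ (Fin F)) (α : Fin K → ℝ)
    (v : Fin N → EuclideanSpace ℝ (Fin F)) (k : Fin K) : Finset (Fin N) :=
  Finset.univ.filter fun n => v n ∈ circularCone (u k) (α k)

/-- The columns lie in the cones and their second moments within each cone are within `η` of
the expected ones. -/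
structure GoodSample (u : Fin K → EuclideanSpace ℝ (Fin F)) (α lam : Fin K → ℝ)
    (v : Fin N → EuclideanSpace ℝ (Fin F)) (η : ℝ) : Prop where
  exists_mem : ∀ n, ∃ k, v n ∈ circularCone (u k) (α k)
  abs_sum_inner_sq_sub_le : ∀ k, |∑ n ∈ coneIndices u α v k, ⟪v n, u k⟫ ^ 2 -
    N * ((1 - fAngle (α k)) / lam k / K)| ≤ N * η
  abs_sum_norm_sq_sub_le : ∀ k, |∑ n ∈ coneIndices u α v k, ‖v n‖ ^ 2 -
    N * (1 / lam k / K)| ≤ N * η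
  norm_sum_le : ∀ k, ‖∑ n ∈ coneIndices u α v k, ⟪v n, u k⟫ • (v n - ⟪v n, u k⟫ • u k)‖ ≤
    2 * (N * η)

/-- A sum over a random index set becomes a sum of `N` independent identically distributed terms. -/
theorem sum_coneIndices (v : Fin N → EuclideanSpace ℝ (Fin F)) (k : Fin K)
    (g : EuclideanSpace ℝ (Fin F) → ℝ) :
    ∑ n ∈ coneIndices u α v k, g (v n) =
      ∑ n, (circularCone (u k) (α k)).indicator g (v n) := by
  classical
  rw [coneIndices, Finset.sum_filter]
  exact Finset.sum_congr rfl fun n _ => by rw [Set.indicator_apply]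

theorem abs_indicator_le {g : EuclideanSpace ℝ (Fin F) → ℝ} (hg : ∀ x, |g x| ≤ ‖x‖ ^ 2)
    (s : Set (EuclideanSpace ℝ (Fin F))) (x : EuclideanSpace ℝ (Fin F)) :
    |s.indicator g x| ≤ ‖x‖ ^ 2 := by
  by_cases hx : x ∈ s
  · rw [Set.indicator_of_mem hx]; exact hg x
  · rw [Set.indicator_of_notMem hx, abs_zero]; positivity

/-- The test functions of the `k`-th cone: plus and minus the squared inner product with `u k`,
plus and minus the squared norm, and the off-diagonal block tested against the vectors of `s`. -/
def testFun (u : Fin K → EuclideanSpace ℝ (Fin F)) (s : Finset (EuclideanSpace ℝ (Fin F))) :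
    Fin K × (Fin 4 ⊕ s) → EuclideanSpace ℝ (Fin F) → ℝ
  | (k, Sum.inl i) =>
      ![fun x => ⟪x, u k⟫ ^ 2, fun x => -⟪x, u k⟫ ^ 2, fun x => ‖x‖ ^ 2, fun x => -‖x‖ ^ 2] i
  | (k, Sum.inr v) => fun x => ⟪x, u k⟫ * ⟪x - ⟪x, u k⟫ • u k, (v : EuclideanSpace ℝ (Fin F))⟫

/-- The expected values of the test functions under the law of the `k`-th cone. -/
def testMean (α lam : Fin K → ℝ) (s : Finset (EuclideanSpace ℝ (Fin F))) :
    Fin K × (Fin 4 ⊕ s) → ℝ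
  | (k, Sum.inl i) =>
      ![(1 - fAngle (α k)) / lam k, -((1 - fAngle (α k)) / lam k), 1 / lam k, -(1 / lam k)] i
  | (_, Sum.inr _) => 0

theorem continuous_testFun (s : Finset (EuclideanSpace ℝ (Fin F))) (i : Fin K × (Fin 4 ⊕ s)) :
    Continuous (testFun u s i) := by
  rcases i with ⟨k, i | v⟩
  · fin_cases i <;> simp [testFun] <;> fun_prop
  · simp only [testFun]; fun_prop

theorem abs_testFun_le (hu : ∀ k, ‖u k‖ = 1) {s : Finset (EuclideanSpace ℝ (Fin F))}
    (hs : ∀ v ∈ s, ‖v‖ = 1) (i : Fin K × (Fin 4 ⊕ s)) (x : EuclideanSpace ℝ (Fin F)) :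
    |testFun u s i x| ≤ ‖x‖ ^ 2 := by
  rcases i with ⟨k, i | v⟩
  · have h1 : ⟪x, u k⟫ ^ 2 ≤ ‖x‖ ^ 2 := sq_le_sq' (by
      linarith [neg_abs_le ⟪x, u k⟫, abs_inner_le_norm (hu k) x])
      ((le_abs_self _).trans (abs_inner_le_norm (hu k) x))
    fin_cases i <;> simp [testFun, h1]
  · exact abs_inner_mul_inner_le (hu k) (hs v v.2) x

theorem integral_testFun (h : ∀ k, ConeData F (u k) (α k) (lam k))
    (s : Finset (EuclideanSpace ℝ (Fin F))) (i : Fin K × (Fin 4 ⊕ s)) :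
    ∫ x, testFun u s i x ∂coneLaw (u i.1) (α i.1) (lam i.1) = testMean α lam s i := by
  rcases i with ⟨k, i | v⟩
  · have h1 := (h k).integral_inner_sq
    have h2 := (h k).integral_norm_sq
    fin_cases i <;> simp [testFun, testMean, integral_neg, h1, h2]
  · exact (h k).integral_inner_mul_inner v

/-- `C` is chosen before `F` and `u`: the dimension enters only through the number of tests, four
scalar ones and at most `5 ^ F` net vectors for each cone. -/
theorem exists_goodSample (hlam : ∀ k, 0 < lam k) (hK : 1 ≤ K) : ∃ C : ℝ, 0 < C ∧
    ∀ (F : ℕ) (u : Fin K → EuclideanSpace ℝ (Fin F)),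
      (∀ k, ConeData F (u k) (α k) (lam k)) →
      (Pairwise fun i j => Disjoint (circularCone (u i) (α i)) (circularCone (u j) (α j))) →
      ∀ (N : ℕ) (η : ℝ), 0 ≤ η → η ≤ 1 →
      ∃ G : Set (Fin N → EuclideanSpace ℝ (Fin F)), MeasurableSet G ∧
        ENNReal.ofReal (1 - K * (4 + 5 ^ F) * Real.exp (-(N * η ^ 2 / (4 * C)))) ≤
          dataLaw N u α lam G ∧
        ∀ v ∈ G, GoodSample u α lam v η := by
  have : Nonempty (Fin K) := ⟨⟨0, hK⟩⟩
  have hK0 : (0 : ℝ) < K := by exact_mod_cast hK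
  -- Below every rate, the exponential moment of order `s₀` of the squared length is finite for all
  -- cones at once.
  obtain ⟨s₀, hs₀, hs₀'⟩ : ∃ s₀ : ℝ, 0 < s₀ ∧ ∀ k, s₀ < lam k := by
    obtain ⟨j, hj⟩ := Finite.exists_min lam
    exact ⟨lam j / 2, by linarith [hlam j], fun k => by linarith [hj k, hlam j]⟩
  let D : Fin K → ℝ := fun k => ∫ l, l ^ 2 * Real.exp (s₀ * l) ∂expMeasure (lam k)
  have hD : ∀ k, 0 ≤ D k := fun k => integral_nonneg fun l => by positivity
  have hDs : 0 ≤ ∑ k, D k := Finset.sum_nonneg fun k _ => hD k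
  -- The extra summand ensures `1 ≤ 2 * C * s₀`, so every `η ≤ 1` is admissible in the Bernstein
  -- bound.
  refine ⟨∑ k, D k + 1 / (2 * s₀), by positivity, ?_⟩
  intro F u h hd N η hη hη1
  obtain ⟨s, hcard, hs1, hsnet⟩ := exists_half_net F
  have := isProbabilityMeasure_columnLaw hK h
  let S : Set (EuclideanSpace ℝ (Fin F)) := ⋃ k, circularCone (u k) (α k)
  have hS : MeasurableSet S := MeasurableSet.iUnion fun k => measurableSet_circularCone
  have hSμ : ∀ᵐ x ∂columnLaw u α lam, x ∈ S := by
    filter_upwards [ae_columnLaw h] with x hx using Set.mem_iUnion.2 hx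
  let Y : Fin K × (Fin 4 ⊕ s) → EuclideanSpace ℝ (Fin F) → ℝ := fun i =>
    (circularCone (u i.1) (α i.1)).indicator (testFun u s i)
  have hu : ∀ k, ‖u k‖ = 1 := fun k => (h k).norm_eq
  have hY : ∀ i, Measurable (Y i) := fun i =>
    (continuous_testFun s i).measurable.indicator measurableSet_circularCone
  have hYZ : ∀ i x, |Y i x| ≤ ‖x‖ ^ 2 := fun i =>
    abs_indicator_le (abs_testFun_le hu hs1 i) _
  have hexp : ∀ k, Integrable (fun l => l ^ 2 * Real.exp (s₀ * l)) (expMeasure (lam k)) :=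
    fun k => integrable_pow_mul_exp_expMeasure (hlam k) (hs₀' k) 2
  have hint' : ∀ k, Integrable (fun x => (‖x‖ ^ 2) ^ 2 * Real.exp (s₀ * ‖x‖ ^ 2))
      (coneLaw (u k) (α k) (lam k)) := fun k => (h k).integrable_comp_norm_sq (hexp k)
  have hC : ∫ x, (‖x‖ ^ 2) ^ 2 * Real.exp (s₀ * ‖x‖ ^ 2) ∂columnLaw u α lam ≤
      ∑ k, D k + 1 / (2 * s₀) := by
    rw [integral_columnLaw hK hint']
    have h1 : ∑ k, ∫ x, (‖x‖ ^ 2) ^ 2 * Real.exp (s₀ * ‖x‖ ^ 2) ∂coneLaw (u k) (α k) (lam k) =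
        ∑ k, D k := Finset.sum_congr rfl fun k _ => (h k).integral_comp_norm_sq (hexp k)
    rw [h1]
    have h2 : (K : ℝ)⁻¹ * ∑ k, D k ≤ ∑ k, D k :=
      mul_le_of_le_one_left hDs (inv_le_one_of_one_le₀ (by exact_mod_cast hK))
    have h3 : 0 ≤ 1 / (2 * s₀) := by positivity
    linarith
  have hm : ∀ i, ∫ x, Y i x ∂columnLaw u α lam ≤ testMean α lam s i / K := by
    intro i
    rw [integral_indicator_columnLaw hK h hd i.1 fun k => (h k).integrable_of_abs_le
      (continuous_testFun s i).measurable (abs_testFun_le hu hs1 i), integral_testFun h s i]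
  have hYi : ∀ i, Integrable (Y i) (columnLaw u α lam) := fun i =>
    integrable_columnLaw hK fun k => (h k).integrable_of_abs_le (hY i) (hYZ i)
  obtain ⟨G, hGm, hGP, hG⟩ := exists_measurableSet_forall_sum_le (s₀ := s₀) (η := η)
    hS hSμ N hY hYZ (integrable_columnLaw hK hint') hC (by positivity) hYi hm hη
    (hη1.trans (by field_simp; nlinarith))
  refine ⟨G, hGm, le_trans (ENNReal.ofReal_le_ofReal ?_) hGP, fun v hv => ?_⟩
  · have h1 : (Fintype.card (Fin K × (Fin 4 ⊕ s)) : ℝ) ≤ K * (4 + 5 ^ F) := by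
      simp only [Fintype.card_prod, Fintype.card_fin, Fintype.card_sum, Fintype.card_coe]
      push_cast
      gcongr
      exact_mod_cast hcard
    gcongr
  · obtain ⟨hvS, hvY⟩ := hG v hv
    have hsum : ∀ i : Fin K × (Fin 4 ⊕ s), ∑ n ∈ coneIndices u α v i.1, testFun u s i (v n) ≤
        N * (testMean α lam s i / K + η) := by
      intro i
      rw [sum_coneIndices]
      exact hvY i
    refine ⟨fun n => Set.mem_iUnion.1 (hvS n), fun k => ?_, fun k => ?_, fun k => ?_⟩
    · have h1 := hsum (k, Sum.inl 0)
      have h2 := hsum (k, Sum.inl 1)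
      simp only [testFun, testMean, Matrix.cons_val_zero, Matrix.cons_val_one,
        Finset.sum_neg_distrib, neg_div] at h1 h2
      rw [abs_le]
      constructor <;> linarith
    · have h1 := hsum (k, Sum.inl 2)
      have h2 := hsum (k, Sum.inl 3)
      simp only [testFun, testMean, Matrix.cons_val,
        Finset.sum_neg_distrib, neg_div] at h1 h2
      rw [abs_le]
      constructor <;> linarith
    · refine norm_le_two_mul_of_net hsnet (by positivity) fun w hw => ?_
      have h1 := hsum (k, Sum.inr ⟨w, hw⟩)
      simp only [testFun, testMean, zero_div, zero_add] at h1
      rw [sum_inner]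
      simpa only [inner_smul_left, conj_trivial] using h1

end GoodSample

/-! ### Greedy clustering separates the cones -/

section Clustering

open InnerProductGeometry

variable {F K N : ℕ} {u : Fin K → EuclideanSpace ℝ (Fin F)} {α lam : Fin K → ℝ}

theorem angle_le_of_mem_circularCone {u x : EuclideanSpace ℝ (Fin F)} {α : ℝ} (hu : ‖u‖ = 1)
    (hα : 0 ≤ α) (hα' : α ≤ Real.pi) (hx : x ∈ circularCone u α) : angle x u ≤ α := by
  rw [angle, hu, mul_one, ← Real.arccos_cos hα hα']
  exact Real.antitone_arccos hx.2

theorem inner_normalizedColumn (v : Fin N → EuclideanSpace ℝ (Fin F)) (m n : Fin N) :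
    ⟪normalizedColumn (dataMatrix v) m, normalizedColumn (dataMatrix v) n⟫ =
      Real.cos (angle (v m) (v n)) := by
  have h : ∀ n, normalizedColumn (dataMatrix v) n = ‖v n‖⁻¹ • v n := fun n => rfl
  rw [h, h, inner_smul_left, inner_smul_right, cos_angle]
  simp only [conj_trivial]
  rw [div_eq_inv_mul, mul_inv]
  ring

/-- The geometric part of the assumptions on the cones. -/
structure ConesSeparated (u : Fin K → EuclideanSpace ℝ (Fin F)) (α : Fin K → ℝ) : Prop where
  norm_eq : ∀ k, ‖u k‖ = 1
  pos : ∀ k, 0 < α k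
  lt : ∀ k, α k < Real.pi / 2
  geom : GeometricAssumption u α

namespace ConesSeparated

variable (h : ConesSeparated u α)
include h

theorem angle_le (k : Fin K) {x y : EuclideanSpace ℝ (Fin F)} (hx : x ∈ circularCone (u k) (α k))
    (hy : y ∈ circularCone (u k) (α k)) : angle x y ≤ 2 * α k := by
  have hpi : α k ≤ Real.pi := by linarith [h.lt k, Real.pi_pos]
  have h1 := angle_le_of_mem_circularCone (h.norm_eq k) (h.pos k).le hpi hx
  have h2 := angle_le_of_mem_circularCone (h.norm_eq k) (h.pos k).le hpi hy
  have h3 := angle_le_angle_add_angle x (u k) y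
  rw [angle_comm (u k) y] at h3
  linarith

/-- By the triangle inequality for angles it is enough that the angle of the axes exceeds `2 α_p +
α_i + α_j`. Comparing `α_p` with `α_i` and `α_j` shows that one of the assumed bounds `α_a + 3 α_b`
dominates this. A third cone `p` must be allowed, since the greedy step compares angles inside one
cone with angles between two others. -/
theorem lt_angle {i j : Fin K} (hij : i ≠ j) (p : Fin K) {x y : EuclideanSpace ℝ (Fin F)}
    (hx : x ∈ circularCone (u i) (α i)) (hy : y ∈ circularCone (u j) (α j)) :
    2 * α p < angle x y := by
  have hpi : ∀ k, α k ≤ Real.pi := fun k => by linarith [h.lt k, Real.pi_pos]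
  have h1 := angle_le_of_mem_circularCone (h.norm_eq i) (h.pos i).le (hpi i) hx
  have h2 := angle_le_of_mem_circularCone (h.norm_eq j) (h.pos j).le (hpi j) hy
  have h3 := angle_le_angle_add_angle (u i) x (u j)
  have h4 := angle_le_angle_add_angle x y (u j)
  rw [angle_comm (u i) x] at h3
  have h5 : angle (u i) (u j) = Real.arccos ⟪u i, u j⟫ := by
    rw [angle, h.norm_eq, h.norm_eq, one_mul, div_one]
  have hg : ∀ a b : Fin K, a ≠ b → α a + 3 * α b < Real.arccos ⟪u i, u j⟫ := fun a b hab =>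
    (le_max_left _ _).trans_lt (h.geom i j hij a b hab)
  have hij1 := hg i j hij
  have hji := hg j i hij.symm
  suffices 2 * α p + α i + α j < Real.arccos ⟪u i, u j⟫ by linarith
  by_cases hpi' : p = i
  · subst hpi'; linarith
  by_cases hpj : p = j
  · subst hpj; linarith
  have hip := hg i p (Ne.symm hpi')
  have hjp := hg j p (Ne.symm hpj)
  rcases le_total (α i) (α p) with h6 | h6
  · linarith
  rcases le_total (α j) (α p) with h7 | h7 <;> linarith

theorem disjoint : Pairwise fun i j =>
    Disjoint (circularCone (u i) (α i)) (circularCone (u j) (α j)) := by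
  intro i j hij
  refine Set.disjoint_left.2 fun x hx hy => ?_
  have h1 := h.lt_angle hij i hx hy
  rw [angle_self hx.1] at h1
  linarith [h.pos i]

/-- The cosine separates pairs of points of the same cone from pairs of points of different
cones. -/
theorem cos_angle_lt {i j k : Fin K} (hij : i ≠ j) {x y z w : EuclideanSpace ℝ (Fin F)}
    (hx : x ∈ circularCone (u i) (α i)) (hy : y ∈ circularCone (u j) (α j))
    (hz : z ∈ circularCone (u k) (α k)) (hw : w ∈ circularCone (u k) (α k)) :
    Real.cos (angle x y) < Real.cos (angle z w) :=
  Real.cos_lt_cos_of_nonneg_of_le_pi (angle_nonneg z w) (angle_le_pi x y)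
    ((h.angle_le k hz hw).trans_lt (h.lt_angle hij k hx hy))

/-- A repeated cone would contradict minimality, because a point of an unvisited cone has smaller
cosine with all earlier centroids. So the centroids lie in distinct cones, and each column is
closest to the centroid of its own cone. The permutation records the order in which cones are
visited. -/
theorem exists_perm_cluster_eq {v : Fin N → EuclideanSpace ℝ (Fin F)}
    (hv : ∀ n, ∃ k, v n ∈ circularCone (u k) (α k))
    (hne : ∀ k, ∃ n, v n ∈ circularCone (u k) (α k)) {cl : Fin N → Fin K}
    (hcl : IsGreedyClustering (dataMatrix v) cl) :
    ∃ σ : Equiv.Perm (Fin K), ∀ k, cluster cl (σ k) = coneIndices u α v k := by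
  obtain ⟨cen, hcen, hmax⟩ := hcl
  simp only [inner_normalizedColumn] at hmax
  choose lab hlab using hv
  have hinj : Function.Injective fun k => lab (cen k) := by
    have key : ∀ k i, i < k → lab (cen i) ≠ lab (cen k) := by
      intro k i hik heq
      -- Fewer than `K` centroids precede `k`, so some cone is still unvisited.
      obtain ⟨j, hj⟩ : ∃ j, j ∉ (Finset.Iio k).image fun i => lab (cen i) := by
        by_contra! hall
        have h1 : (Finset.univ : Finset (Fin K)).card ≤ _ :=
          Finset.card_le_card fun j _ => hall j
        have h2 := h1.trans Finset.card_image_le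
        rw [Finset.card_univ, Fintype.card_fin, Fin.card_Iio] at h2
        omega
      obtain ⟨n, hn⟩ := hne j
      have h1 := hcen k ⟨i, Finset.mem_Iio.2 hik⟩ n
      simp only [inner_normalizedColumn] at h1
      have h2 := (Finset.le_sup' (fun i => Real.cos (angle (v (cen i)) (v (cen k))))
        (Finset.mem_Iio.2 hik)).trans h1
      -- The within-cone cosine of centroids `i` and `k` exceeds every cosine between an earlier
      -- centroid and the point `n` of the unvisited cone.
      refine absurd h2 (not_le.2 ((Finset.sup'_lt_iff _).2 fun i' hi' => ?_))
      refine h.cos_angle_lt (fun hi => hj ?_) (hlab (cen i')) hn (hlab (cen i))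
        (heq ▸ hlab (cen k))
      exact Finset.mem_image.2 ⟨i', hi', hi⟩
    intro i k heq
    rcases lt_trichotomy i k with hlt | rfl | hlt
    · exact absurd heq (key k i hlt)
    · rfl
    · exact absurd heq.symm (key i k hlt)
  let σ := Equiv.ofBijective _ (Finite.injective_iff_bijective.1 hinj)
  refine ⟨σ.symm, fun k => ?_⟩
  have hσ : lab (cen (σ.symm k)) = k := σ.apply_symm_apply k
  have hcllab : ∀ n, lab (cen (cl n)) = lab n := by
    intro n
    by_contra hne'
    have hσn : lab (cen (σ.symm (lab n))) = lab n := σ.apply_symm_apply _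
    refine absurd (hmax n (σ.symm (lab n))) (not_le.2 ?_)
    have hmem := hlab (cen (σ.symm (lab n)))
    rw [hσn] at hmem
    exact h.cos_angle_lt hne' (hlab _) (hlab n) hmem (hlab n)
  ext n
  simp only [cluster, coneIndices, Finset.mem_filter, Finset.mem_univ, true_and]
  constructor
  · intro hn
    have h1 := hcllab n
    rw [hn, hσ] at h1
    exact h1 ▸ hlab n
  · intro hn
    have h1 : lab n = k := by
      by_contra hne'
      exact Set.disjoint_left.1 (h.disjoint hne') (hlab n) hn
    refine hinj ?_
    simp only [hσ, hcllab, h1]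

end ConesSeparated

theorem exists_isGreedyClustering (hK : 1 ≤ K) (hN : 1 ≤ N) (V : Matrix (Fin F) (Fin N) ℝ) :
    ∃ cl : Fin N → Fin K, IsGreedyClustering V cl := by
  have : Nonempty (Fin N) := ⟨⟨0, hN⟩⟩
  have : Nonempty (Fin K) := ⟨⟨0, hK⟩⟩
  have hstep : ∀ m : ℕ, ∃ cen : Fin K → Fin N, ∀ k : Fin K, (k : ℕ) < m →
      ∀ (h : (Finset.Iio k).Nonempty) (n : Fin N),
      (Finset.Iio k).sup' h (fun i => ⟪normalizedColumn V (cen i), normalizedColumn V (cen k)⟫) ≤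
        (Finset.Iio k).sup' h (fun i => ⟪normalizedColumn V (cen i), normalizedColumn V n⟫) := by
    intro m
    induction m with
    | zero => exact ⟨fun _ => Classical.arbitrary _, fun k hk => absurd hk (Nat.not_lt_zero _)⟩
    | succ m ih =>
      obtain ⟨cen, hcen⟩ := ih
      -- The first centroid is unconstrained and keeps its arbitrary value. Otherwise entry `m` is
      -- replaced by a minimizer; the conditions for smaller indices do not involve that entry.
      by_cases hm : ∃ hmK : m < K, (Finset.Iio (⟨m, hmK⟩ : Fin K)).Nonempty
      · obtain ⟨hmK, hne⟩ := hm
        obtain ⟨n₀, hn₀⟩ := Finite.exists_min fun n => (Finset.Iio (⟨m, hmK⟩ : Fin K)).sup' hne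
          fun i => ⟪normalizedColumn V (cen i), normalizedColumn V n⟫
        refine ⟨Function.update cen ⟨m, hmK⟩ n₀, fun k hk h n => ?_⟩
        have hlt : ∀ i ∈ Finset.Iio k, Function.update cen ⟨m, hmK⟩ n₀ i = cen i := by
          intro i hi
          refine Function.update_of_ne (fun heq => ?_) _ _
          have := Fin.lt_def.1 (Finset.mem_Iio.1 hi)
          rw [heq] at this
          simp only at this
          omega
        have hsup : ∀ x, (Finset.Iio k).sup' h (fun i =>
            ⟪normalizedColumn V (Function.update cen ⟨m, hmK⟩ n₀ i), x⟫) =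
            (Finset.Iio k).sup' h (fun i => ⟪normalizedColumn V (cen i), x⟫) := fun x =>
          Finset.sup'_congr h rfl fun i hi => by rw [hlt i hi]
        rw [hsup, hsup]
        rcases Nat.lt_succ_iff_lt_or_eq.1 hk with hk' | hk'
        · rw [Function.update_of_ne (by rintro rfl; exact lt_irrefl _ hk')]
          exact hcen k hk' h n
        · obtain rfl : k = ⟨m, hmK⟩ := Fin.ext hk'
          rw [Function.update_self]
          exact hn₀ n
      · refine ⟨cen, fun k hk h n => ?_⟩
        rcases Nat.lt_succ_iff_lt_or_eq.1 hk with hk' | hk'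
        · exact hcen k hk' h n
        · exact absurd ⟨hk' ▸ k.2, by convert h; exact hk'.symm⟩ hm
  obtain ⟨cen, hcen⟩ := hstep K
  choose cl hcl using fun n => Finite.exists_max fun j =>
    ⟪normalizedColumn V (cen j), normalizedColumn V n⟫
  exact ⟨cl, cen, fun k h n => hcen k k.2 h n, hcl⟩

end Clustering

/-! ### Singular value decompositions -/

section SVD

variable {m n : ℕ}

/-- The matrix whose columns are the vectors of an orthonormal basis is orthogonal. -/
theorem of_orthonormalBasis_mem_orthogonalGroup
    (b : OrthonormalBasis (Fin n) ℝ (EuclideanSpace ℝ (Fin n))) :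
    Matrix.of (fun i j => b j i) ∈ Matrix.orthogonalGroup (Fin n) ℝ := by
  rw [Matrix.mem_orthogonalGroup_iff']
  ext i j
  have h := orthonormal_iff_ite.1 b.orthonormal i j
  rw [PiLp.inner_apply] at h
  simp only [Matrix.mul_apply, Matrix.of_apply, Matrix.one_apply]
  rw [← h]
  exact Finset.sum_congr rfl fun k _ => by simp [mul_comm]

/-- The rectangular diagonal matrix with diagonal `s`. -/
def rectDiagonal (m n : ℕ) (s : ℕ → ℝ) : Matrix (Fin m) (Fin n) ℝ :=
  Matrix.of fun (i : Fin m) (j : Fin n) => if (i : ℕ) = (j : ℕ) then s i else 0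

/-- Right singular vectors are an eigenbasis of `AᵀA`. Their images are orthogonal with norms the
singular values; the nonzero ones, normalized and completed to an orthonormal basis, are the left
singular vectors. This gives `A X = U Σ`. -/
theorem exists_isSVD (A : Matrix (Fin m) (Fin n) ℝ) : ∃ U s X, IsSVD A U s X := by
  set T := Matrix.toEuclideanLin A with hT
  have hn : Module.finrank ℝ (EuclideanSpace ℝ (Fin n)) = n := finrank_euclideanSpace_fin
  set x := T.isSymmetric_adjoint_comp_self.eigenvectorBasis hn with hx
  have hTx : ∀ i j : Fin n, ⟪T (x i), T (x j)⟫ =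
      if i = j then (T.singularValues j : ℝ) ^ 2 else 0 := by
    intro i j
    rw [← LinearMap.adjoint_inner_right, ← LinearMap.comp_apply, hx,
      LinearMap.IsSymmetric.apply_eigenvectorBasis, inner_smul_right,
      orthonormal_iff_ite.1 (OrthonormalBasis.orthonormal _) i j, T.sq_singularValues_fin hn]
    split_ifs <;> simp
  let s : ℕ → ℝ := fun p => T.singularValues p
  -- The default value is harmless: singular values from index `n` on vanish, and only indices with
  -- `s i ≠ 0` are retained.
  let w : Fin m → EuclideanSpace ℝ (Fin m) := fun i =>
    if h : (i : ℕ) < n then (s i)⁻¹ • T (x ⟨i, h⟩) else 0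
  have hsn : ∀ p, s p ≠ 0 → p < n := by
    intro p hp
    by_contra! hle
    exact hp (T.singularValues_of_finrank_le (by rw [hn]; exact hle))
  have horth : Orthonormal ℝ (({i : Fin m | s i ≠ 0} : Set (Fin m)).domRestrict w) := by
    rw [orthonormal_iff_ite]
    rintro ⟨i, hi⟩ ⟨j, hj⟩
    have hi' := hsn _ hi
    have hj' := hsn _ hj
    have h1 : ⟪w i, w j⟫ = if i = j then 1 else 0 := by
      simp only [w, dif_pos hi', dif_pos hj', inner_smul_left, inner_smul_right, hTx,
        conj_trivial, Fin.mk.injEq, ← Fin.ext_iff]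
      split_ifs with hij
      · subst hij
        have hi0 : s i ≠ 0 := hi
        change (s i)⁻¹ * ((s i)⁻¹ * s i ^ 2) = 1
        field_simp
      · simp
    simpa using h1
  obtain ⟨y, hy⟩ := horth.exists_orthonormalBasis_extension_of_card_eq (by simp)
  have hTxj : ∀ j : Fin n, T (x j) = if h : (j : ℕ) < m then s j • y ⟨j, h⟩ else 0 := by
    intro j
    by_cases hsj : s j = 0
    · have h0 : T (x j) = 0 := by
        have := hTx j j
        rw [if_pos rfl] at this
        change _ = s j ^ 2 at this
        rw [hsj] at this
        exact inner_self_eq_zero.1 (by rw [this]; norm_num)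
      rw [h0]
      split_ifs <;> simp [hsj]
    -- The index of a nonzero singular value is below the rank, hence below `m`.
    · have hjm : (j : ℕ) < m := by
        have h1 : (0 : ℝ) < T.singularValues j :=
          (T.singularValues_pos_iff_ne_zero j).2 hsj
        have h2 := T.singularValues_pos_iff_lt_finrank_range.1 h1
        have h3 := Submodule.finrank_le (LinearMap.range T)
        rw [finrank_euclideanSpace_fin] at h3
        omega
      rw [dif_pos hjm, hy ⟨j, hjm⟩ hsj]
      simp only [w, dif_pos j.2]
      rw [smul_smul, mul_inv_cancel₀ hsj, one_smul]
  have hX := of_orthonormalBasis_mem_orthogonalGroup x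
  refine ⟨Matrix.of fun i j => y j i, s, Matrix.of fun i j => x j i,
    of_orthonormalBasis_mem_orthogonalGroup y, hX, fun i j hij => T.singularValues_antitone hij,
    fun p => T.singularValues_nonneg p, ?_⟩
  have hAX : A * Matrix.of (fun i j => x j i) =
      Matrix.of (fun i j => y j i) * rectDiagonal m n s := by
    ext i j
    have h1 : (A * Matrix.of fun i j => x j i) i j = T (x j) i := by
      simp [hT, Matrix.mul_apply, Matrix.toLpLin_apply, Matrix.mulVec, dotProduct]
    rw [h1, hTxj, Matrix.mul_apply]
    by_cases hjm : (j : ℕ) < m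
    · rw [dif_pos hjm, Finset.sum_eq_single ⟨j, hjm⟩]
      · simp [rectDiagonal, mul_comm]
      · intro k _ hk
        have : (k : ℕ) ≠ j := fun h => hk (Fin.ext h)
        simp [rectDiagonal, this]
      · simp
    · rw [dif_neg hjm]
      refine (Finset.sum_eq_zero fun k _ => ?_).symm
      have : (k : ℕ) ≠ j := by omega
      simp [rectDiagonal, this]
  change A = _ * rectDiagonal m n s * _
  rw [← hAX, Matrix.mul_assoc]
  rw [(Matrix.mem_orthogonalGroup_iff _ _).1 hX, Matrix.mul_one]

theorem transpose_mul_self_of_mem_orthogonalGroup {U : Matrix (Fin n) (Fin n) ℝ}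
    (hU : U ∈ Matrix.orthogonalGroup (Fin n) ℝ) : Uᵀ * U = 1 ∧ U * Uᵀ = 1 :=
  ⟨(Matrix.mem_orthogonalGroup_iff' _ _).1 hU, (Matrix.mem_orthogonalGroup_iff _ _).1 hU⟩

theorem dotProduct_transpose_mulVec_self {U : Matrix (Fin n) (Fin n) ℝ}
    (hU : U ∈ Matrix.orthogonalGroup (Fin n) ℝ) (a : Fin n → ℝ) :
    (Uᵀ *ᵥ a) ⬝ᵥ (Uᵀ *ᵥ a) = a ⬝ᵥ a := by
  rw [Matrix.dotProduct_mulVec, Matrix.vecMul_transpose, Matrix.mulVec_mulVec,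
    (transpose_mul_self_of_mem_orthogonalGroup hU).2, Matrix.one_mulVec]

theorem col_dotProduct_self {U : Matrix (Fin n) (Fin n) ℝ}
    (hU : U ∈ Matrix.orthogonalGroup (Fin n) ℝ) (j : Fin n) : U.col j ⬝ᵥ U.col j = 1 := by
  have h := congrFun (congrFun (transpose_mul_self_of_mem_orthogonalGroup hU).1 j) j
  rw [Matrix.one_apply_eq] at h
  rw [← h]
  rfl

/-- Termwise `2 s_i a_i b_i ≤ s_0 (a_i² + b_i²)`, and each row and each column has at most one
diagonal entry. This form of the operator norm bound avoids square roots. -/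
theorem two_mul_dotProduct_rectDiagonal_le {s : ℕ → ℝ} (hs : Antitone s) (hs0 : ∀ p, 0 ≤ s p)
    (a : Fin m → ℝ) (b : Fin n → ℝ) :
    2 * (a ⬝ᵥ rectDiagonal m n s *ᵥ b) ≤ s 0 * (a ⬝ᵥ a + b ⬝ᵥ b) := by
  have h1 : 2 * (a ⬝ᵥ rectDiagonal m n s *ᵥ b) ≤
      ∑ i : Fin m, ∑ j : Fin n, ((if (i : ℕ) = j then s 0 * a i ^ 2 else 0) +
        if (i : ℕ) = j then s 0 * b j ^ 2 else 0) := by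
    simp only [dotProduct, Matrix.mulVec, rectDiagonal, Matrix.of_apply, Finset.mul_sum]
    refine Finset.sum_le_sum fun i _ => Finset.sum_le_sum fun j _ => ?_
    split_ifs
    · have h2 : s i ≤ s 0 := hs (Nat.zero_le _)
      nlinarith [hs0 i, sq_nonneg (a i - b j), sq_nonneg (a i), sq_nonneg (b j),
        mul_nonneg (hs0 i) (sq_nonneg (a i - b j)),
        mul_nonneg (sub_nonneg.2 h2) (add_nonneg (sq_nonneg (a i)) (sq_nonneg (b j)))]
    · simp
  refine h1.trans ?_
  simp only [Finset.sum_add_distrib]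
  rw [mul_add]
  have h3 : ∀ i : Fin m, ∑ j : Fin n, (if (i : ℕ) = j then s 0 * a i ^ 2 else 0) ≤
      s 0 * a i ^ 2 := by
    intro i
    have h0 : 0 ≤ s 0 * a i ^ 2 := mul_nonneg (hs0 0) (sq_nonneg _)
    by_cases hi : (i : ℕ) < n
    · rw [Finset.sum_eq_single ⟨i, hi⟩]
      · simp
      · intro j _ hj
        exact if_neg fun h => hj (Fin.ext h.symm)
      · simp
    · rw [Finset.sum_eq_zero fun j _ => if_neg fun h : (i : ℕ) = (j : Fin n) => hi (h ▸ j.2)]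
      exact h0
  have h4 : ∀ j : Fin n, ∑ i : Fin m, (if (i : ℕ) = j then s 0 * b j ^ 2 else 0) ≤
      s 0 * b j ^ 2 := by
    intro j
    have h0 : 0 ≤ s 0 * b j ^ 2 := mul_nonneg (hs0 0) (sq_nonneg _)
    by_cases hj : (j : ℕ) < m
    · rw [Finset.sum_eq_single ⟨j, hj⟩]
      · simp
      · intro i _ hi
        exact if_neg fun h => hi (Fin.ext h)
      · simp
    · rw [Finset.sum_eq_zero fun i _ => if_neg fun h : ((i : Fin m) : ℕ) = j => hj (h ▸ i.2)]
      exact h0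
  refine add_le_add ?_ ?_
  · simp only [dotProduct, Finset.mul_sum]
    exact Finset.sum_le_sum fun i _ => (h3 i).trans (by rw [sq])
  · rw [Finset.sum_comm]
    simp only [dotProduct, Finset.mul_sum]
    exact Finset.sum_le_sum fun j _ => (h4 j).trans (by rw [sq])

namespace IsSVD

variable {A : Matrix (Fin m) (Fin n) ℝ} {U : Matrix (Fin m) (Fin m) ℝ} {s : ℕ → ℝ}
  {X : Matrix (Fin n) (Fin n) ℝ} (h : IsSVD A U s X)
include h

theorem two_mul_dotProduct_le (a : Fin m → ℝ) (b : Fin n → ℝ) :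
    2 * (a ⬝ᵥ A *ᵥ b) ≤ s 0 * (a ⬝ᵥ a + b ⬝ᵥ b) := by
  obtain ⟨hU, hX, hs, hs0, hA⟩ := h
  have h1 := two_mul_dotProduct_rectDiagonal_le hs hs0 (Uᵀ *ᵥ a) (Xᵀ *ᵥ b)
  rw [dotProduct_transpose_mulVec_self hU, dotProduct_transpose_mulVec_self hX] at h1
  have h2 : a ⬝ᵥ A *ᵥ b = (Uᵀ *ᵥ a) ⬝ᵥ rectDiagonal m n s *ᵥ (Xᵀ *ᵥ b) := by
    rw [hA, ← Matrix.mulVec_mulVec, ← Matrix.mulVec_mulVec, Matrix.dotProduct_mulVec a,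
      ← Matrix.mulVec_transpose]
    rfl
  rwa [h2]

theorem col_dotProduct_mulVec_col (hm : 0 < m) (hn : 0 < n) :
    U.col ⟨0, hm⟩ ⬝ᵥ A *ᵥ X.col ⟨0, hn⟩ = s 0 := by
  obtain ⟨hU, hX, hs, hs0, hA⟩ := h
  have h1 : Uᵀ * A * X = rectDiagonal m n s := by
    rw [hA, Matrix.mul_assoc, Matrix.mul_assoc, (transpose_mul_self_of_mem_orthogonalGroup hX).1,
      Matrix.mul_one, ← Matrix.mul_assoc, (transpose_mul_self_of_mem_orthogonalGroup hU).1,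
      Matrix.one_mul]
    rfl
  have h2 := congrFun (congrFun h1 ⟨0, hm⟩) ⟨0, hn⟩
  rw [Matrix.mul_assoc] at h2
  rw [show s 0 = rectDiagonal m n s ⟨0, hm⟩ ⟨0, hn⟩ by simp [rectDiagonal], ← h2]
  rfl

/-- Test the bilinear bound with `b` a multiple `r` of `aᵀA`: `r = 1 / s 0` is optimal, and when `s
0 = 0` the choice `r = 1` forces `aᵀA` to vanish. -/
theorem vecMul_dotProduct_self_le (a : Fin m → ℝ) (ha : a ⬝ᵥ a = 1) :
    (a ᵥ* A) ⬝ᵥ (a ᵥ* A) ≤ s 0 ^ 2 := by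
  have hs0 : 0 ≤ s 0 := h.2.2.2.1 0
  have key : ∀ r : ℝ, 2 * (r * ((a ᵥ* A) ⬝ᵥ (a ᵥ* A))) ≤
      s 0 * (1 + r ^ 2 * ((a ᵥ* A) ⬝ᵥ (a ᵥ* A))) := by
    intro r
    have h1 := h.two_mul_dotProduct_le a (r • (a ᵥ* A))
    rw [Matrix.dotProduct_mulVec, dotProduct_smul, smul_dotProduct, dotProduct_smul, ha] at h1
    simp only [smul_eq_mul] at h1
    rw [sq, mul_assoc]
    exact h1
  rcases hs0.eq_or_lt with h0 | h0
  · have := key 1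
    rw [← h0] at this ⊢
    linarith
  · have h1 := mul_le_mul_of_nonneg_left (key (s 0)⁻¹) h0.le
    field_simp at h1
    linarith

theorem sq_le_vecMul_dotProduct_self (hm : 0 < m) (hn : 0 < n) :
    s 0 ^ 2 ≤ (U.col ⟨0, hm⟩ ᵥ* A) ⬝ᵥ (U.col ⟨0, hm⟩ ᵥ* A) := by
  have h1 := h.col_dotProduct_mulVec_col hm hn
  have h2 := col_dotProduct_self h.2.1 ⟨0, hn⟩
  rw [Matrix.dotProduct_mulVec] at h1
  have h3 := Finset.sum_mul_sq_le_sq_mul_sq Finset.univ (U.col ⟨0, hm⟩ ᵥ* A) (X.col ⟨0, hn⟩)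
  simp only [sq] at h3
  change (_ ⬝ᵥ _) * (_ ⬝ᵥ _) ≤ (_ ⬝ᵥ _) * (_ ⬝ᵥ _) at h3
  rw [h1, h2, mul_one] at h3
  rw [sq]
  exact h3

/-- For an entrywise nonnegative matrix, the moduli of the leading singular vectors give a best
rank-one approximation. -/
theorem sum_sub_abs_mul_abs_sq (hm : 0 < m) (hn : 0 < n) (hA : ∀ i j, 0 ≤ A i j) :
    ∑ i, ∑ j, (A i j - |U i ⟨0, hm⟩| * (s 0 * |X j ⟨0, hn⟩|)) ^ 2 =
      ∑ i, ∑ j, A i j ^ 2 - s 0 ^ 2 := by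
  set a : Fin m → ℝ := fun i => |U i ⟨0, hm⟩|
  set b : Fin n → ℝ := fun j => |X j ⟨0, hn⟩|
  have ha : a ⬝ᵥ a = 1 := by
    rw [← col_dotProduct_self h.1 ⟨0, hm⟩]
    exact Finset.sum_congr rfl fun i _ => abs_mul_abs_self _
  have hb : b ⬝ᵥ b = 1 := by
    rw [← col_dotProduct_self h.2.1 ⟨0, hn⟩]
    exact Finset.sum_congr rfl fun i _ => abs_mul_abs_self _
  -- The bilinear bound for unit vectors gives `≤`. Since the entries of `A` are nonnegative, taking
  -- moduli can only increase the value attained by the singular vectors, which gives `≥`.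
  have hab : a ⬝ᵥ A *ᵥ b = s 0 := by
    refine le_antisymm ?_ ?_
    · have := h.two_mul_dotProduct_le a b
      rw [ha, hb] at this
      linarith
    · rw [← h.col_dotProduct_mulVec_col hm hn]
      simp only [dotProduct, Matrix.mulVec, Finset.mul_sum]
      refine Finset.sum_le_sum fun i _ => Finset.sum_le_sum fun j _ => ?_
      calc U.col ⟨0, hm⟩ i * (A i j * X.col ⟨0, hn⟩ j)
          ≤ |U.col ⟨0, hm⟩ i * (A i j * X.col ⟨0, hn⟩ j)| := le_abs_self _
        _ = a i * (A i j * b j) := by rw [abs_mul, abs_mul, abs_of_nonneg (hA i j)]; rfl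
  have hexp : ∑ i, ∑ j, (A i j - a i * (s 0 * b j)) ^ 2 = ∑ i, ∑ j, A i j ^ 2 -
      2 * s 0 * (a ⬝ᵥ A *ᵥ b) + s 0 ^ 2 * ((a ⬝ᵥ a) * (b ⬝ᵥ b)) := by
    simp only [dotProduct, Matrix.mulVec, Finset.sum_mul_sum]
    simp only [Finset.mul_sum, ← Finset.sum_sub_distrib, ← Finset.sum_add_distrib]
    refine Finset.sum_congr rfl fun i _ => Finset.sum_congr rfl fun j _ => ?_
    ring
  rw [hexp, hab, ha, hb]
  ring

end IsSVD

end SVD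

/-! ### The error of an output in terms of the clusters -/

section Error

variable {F K N : ℕ}

theorem sum_orderEmbOfFin (I : Finset (Fin N)) (g : Fin N → ℝ) :
    ∑ j, g (I.orderEmbOfFin rfl j) = ∑ n ∈ I, g n := by
  conv_rhs => rw [← Finset.map_orderEmbOfFin_univ I rfl, Finset.sum_map]
  rfl

theorem relativeError_eq (V : Matrix (Fin F) (Fin N) ℝ) (W : Matrix (Fin F) (Fin K) ℝ)
    (H : Matrix (Fin K) (Fin N) ℝ) :
    relativeError V W H = √(∑ i, ∑ n, (V i n - (W * H) i n) ^ 2) / √(∑ i, ∑ n, V i n ^ 2) := by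
  simp only [relativeError, Matrix.frobenius_norm_def, Matrix.sub_apply, Real.norm_eq_abs,
    Real.rpow_two, sq_abs, Real.sqrt_eq_rpow]

theorem norm_sq_eq_sum_sq (x : EuclideanSpace ℝ (Fin F)) : ‖x‖ ^ 2 = ∑ i, x i ^ 2 := by
  rw [EuclideanSpace.norm_sq_eq]
  simp

/-- The squared error on one cluster: the total squared norm minus a number `S` that is the
maximum of `∑ ⟪v n, w⟫ ^ 2` over the unit vectors `w`. -/
theorem IsSVD.exists_sum_error_eq (hF : 0 < F) {v : Fin N → EuclideanSpace ℝ (Fin F)}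
    (hv : ∀ n i, 0 ≤ v n i) {I : Finset (Fin N)} (hI : 0 < I.card)
    {U : Matrix (Fin F) (Fin F) ℝ} {s : ℕ → ℝ} {X : Matrix (Fin I.card) (Fin I.card) ℝ}
    (h : IsSVD (subColumns (dataMatrix v) I) U s X) :
    ∃ S : ℝ, (∑ j, ∑ i, (v (I.orderEmbOfFin rfl j) i -
        |U i ⟨0, hF⟩| * (s 0 * |X j ⟨0, hI⟩|)) ^ 2 = ∑ n ∈ I, ‖v n‖ ^ 2 - S) ∧
      (∀ w : EuclideanSpace ℝ (Fin F), ‖w‖ = 1 → ∑ n ∈ I, ⟪v n, w⟫ ^ 2 ≤ S) ∧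
      ∃ w : EuclideanSpace ℝ (Fin F), ‖w‖ = 1 ∧ S ≤ ∑ n ∈ I, ⟪v n, w⟫ ^ 2 := by
  have hform : ∀ w : EuclideanSpace ℝ (Fin F), ∑ n ∈ I, ⟪v n, w⟫ ^ 2 =
      (WithLp.ofLp w ᵥ* subColumns (dataMatrix v) I) ⬝ᵥ
        (WithLp.ofLp w ᵥ* subColumns (dataMatrix v) I) := by
    intro w
    rw [← sum_orderEmbOfFin I fun n => ⟪v n, w⟫ ^ 2]
    refine Finset.sum_congr rfl fun j _ => ?_
    rw [sq]
    have : ⟪v (I.orderEmbOfFin rfl j), w⟫ =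
        (WithLp.ofLp w ᵥ* subColumns (dataMatrix v) I) j := by
      rw [PiLp.inner_apply]
      rfl
    rw [this]
  have hnorm : ∀ w : EuclideanSpace ℝ (Fin F), WithLp.ofLp w ⬝ᵥ WithLp.ofLp w = ‖w‖ ^ 2 := by
    intro w
    rw [norm_sq_eq_sum_sq]
    exact Finset.sum_congr rfl fun i _ => (sq _).symm
  refine ⟨s 0 ^ 2, ?_, fun w hw => ?_, WithLp.toLp 2 (U.col ⟨0, hF⟩), ?_, ?_⟩
  · have h1 := h.sum_sub_abs_mul_abs_sq hF hI fun i j => hv _ i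
    rw [Finset.sum_comm] at h1
    refine h1.trans ?_
    rw [Finset.sum_comm, ← sum_orderEmbOfFin I fun n => ‖v n‖ ^ 2]
    congr 1
    exact Finset.sum_congr rfl fun j _ => (norm_sq_eq_sum_sq _).symm
  · rw [hform]
    exact h.vecMul_dotProduct_self_le _ (by rw [hnorm, hw]; norm_num)
  · have h1 := hnorm (WithLp.toLp 2 (U.col ⟨0, hF⟩))
    rw [col_dotProduct_self h.1] at h1
    nlinarith [norm_nonneg (WithLp.toLp 2 (U.col ⟨0, hF⟩))]
  · rw [hform]
    exact h.sq_le_vecMul_dotProduct_self hF hI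

theorem sum_cluster (cl : Fin N → Fin K) (g : Fin N → ℝ) :
    ∑ k, ∑ n ∈ cluster cl k, g n = ∑ n, g n :=
  Finset.sum_fiberwise _ _ _

theorem exists_isCr1NMF (hK : 1 ≤ K) (hN : 1 ≤ N) (V : Matrix (Fin F) (Fin N) ℝ) :
    ∃ (W : Matrix (Fin F) (Fin K) ℝ) (H : Matrix (Fin K) (Fin N) ℝ), IsCr1NMF V W H := by
  obtain ⟨cl, hcl⟩ := exists_isGreedyClustering hK hN V
  choose U s X h using fun k => exists_isSVD (subColumns V (cluster cl k))
  refine ⟨Matrix.of fun i k => |U k i ⟨0, i.pos⟩|, Matrix.of fun k =>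
    Function.extend ((cluster cl k).orderEmbOfFin rfl) (fun j => s k 0 * |X k j ⟨0, j.pos⟩|) 0,
    cl, hcl, fun k => ⟨U k, s k, X k, h k, fun i => rfl, fun j => ?_, fun n hn => ?_⟩⟩
  · simp only [Matrix.of_apply]
    exact ((cluster cl k).orderEmbOfFin rfl).injective.extend_apply _ _ j
  · simp only [Matrix.of_apply]
    refine Function.extend_apply' _ _ _ ?_
    rintro ⟨j, rfl⟩
    exact hn (Finset.orderEmbOfFin_mem _ _ j)

namespace IsCr1NMF

variable {V : Matrix (Fin F) (Fin N) ℝ} {W : Matrix (Fin F) (Fin K) ℝ}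
  {H : Matrix (Fin K) (Fin N) ℝ}

theorem nonneg (h : IsCr1NMF V W H) : (∀ i k, 0 ≤ W i k) ∧ ∀ k n, 0 ≤ H k n := by
  obtain ⟨cl, -, h⟩ := h
  refine ⟨fun i k => ?_, fun k n => ?_⟩
  · obtain ⟨U, s, X, -, hW, -, -⟩ := h k
    rw [hW]
    exact abs_nonneg _
  · obtain ⟨U, s, X, hsvd, -, hH, hH0⟩ := h k
    by_cases hn : n ∈ cluster cl k
    · obtain ⟨j, rfl⟩ : n ∈ Set.range ((cluster cl k).orderEmbOfFin rfl) := by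
        rw [Finset.range_orderEmbOfFin]; exact hn
      rw [hH]
      exact mul_nonneg (hsvd.2.2.2.1 0) (abs_nonneg _)
    · rw [hH0 n hn]

/-- The squared error of an output is the sum over the clusters of the total squared norm minus
the squared top singular value. -/
theorem exists_sum_error_eq (hF : 0 < F) {v : Fin N → EuclideanSpace ℝ (Fin F)}
    (hv : ∀ n i, 0 ≤ v n i) (h : IsCr1NMF (dataMatrix v) W H) :
    ∃ cl : Fin N → Fin K, IsGreedyClustering (dataMatrix v) cl ∧
      ((∀ k, (cluster cl k).Nonempty) → ∃ S : Fin K → ℝ,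
        (∑ i, ∑ n, (dataMatrix v i n - (W * H) i n) ^ 2 =
          ∑ k, (∑ n ∈ cluster cl k, ‖v n‖ ^ 2 - S k)) ∧
        ∀ k, (∀ w : EuclideanSpace ℝ (Fin F), ‖w‖ = 1 →
            ∑ n ∈ cluster cl k, ⟪v n, w⟫ ^ 2 ≤ S k) ∧
          ∃ w : EuclideanSpace ℝ (Fin F), ‖w‖ = 1 ∧
            S k ≤ ∑ n ∈ cluster cl k, ⟪v n, w⟫ ^ 2) := by
  obtain ⟨cl, hcl, h⟩ := h
  refine ⟨cl, hcl, fun hne => ?_⟩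
  choose U s X hsvd hW hH hH0 using h
  choose S hS hle hge using fun k =>
    (hsvd k).exists_sum_error_eq hF hv (Finset.card_pos.2 (hne k))
  refine ⟨S, ?_, fun k => ⟨hle k, hge k⟩⟩
  rw [Finset.sum_comm, ← sum_cluster cl]
  refine Finset.sum_congr rfl fun k _ => ?_
  rw [← hS k, ← sum_orderEmbOfFin]
  refine Finset.sum_congr rfl fun j _ => Finset.sum_congr rfl fun i _ => ?_
  have hmem := Finset.orderEmbOfFin_mem (cluster cl k) rfl j
  have hWH : (W * H) i ((cluster cl k).orderEmbOfFin rfl j) =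
      W i k * H k ((cluster cl k).orderEmbOfFin rfl j) := by
    rw [Matrix.mul_apply]
    refine Finset.sum_eq_single k (fun k' _ hk' => ?_) (by simp)
    rw [hH0 k', mul_zero]
    intro hmem'
    simp only [cluster, Finset.mem_filter, Finset.mem_univ, true_and] at hmem hmem'
    exact hk' (hmem'.symm.trans hmem)
  rw [hWH, hW, hH]
  rfl

end IsCr1NMF

end Error

/-! ### The deterministic error bound -/

section Deterministic

/-- The quotients differ by at most `(7 + 1) * d / D`, doubled by `D ≥ D₀ / 2`; the square root
costs a division by the limit `r`, as `|x - r| * r ≤ |x ^ 2 - r ^ 2|`. -/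
theorem abs_sqrt_div_sqrt_sub_le {E E₀ D D₀ d : ℝ} (hE : 0 ≤ E) (hE₀ : 0 < E₀) (hED : E₀ ≤ D₀)
    (h1 : |E - E₀| ≤ 7 * d) (h2 : |D - D₀| ≤ d) (hd : d ≤ D₀ / 2) :
    |√E / √D - √(E₀ / D₀)| ≤ 16 * d / (D₀ * √(E₀ / D₀)) := by
  have hD₀ : 0 < D₀ := hE₀.trans_le hED
  have hd0 : 0 ≤ d := (abs_nonneg _).trans h2
  have hD : D₀ / 2 ≤ D := by linarith [(abs_le.1 h2).1]
  have hDpos : 0 < D := by linarith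
  set r := √(E₀ / D₀)
  have hr : 0 < r := Real.sqrt_pos.2 (by positivity)
  rw [← Real.sqrt_div hE]
  set x := √(E / D)
  have hx : 0 ≤ x := Real.sqrt_nonneg _
  have hxr : |x ^ 2 - r ^ 2| ≤ 16 * d / D₀ := by
    rw [Real.sq_sqrt (by positivity), Real.sq_sqrt (by positivity)]
    have h3 : E / D - E₀ / D₀ = ((E - E₀) * D₀ - E₀ * (D - D₀)) / (D * D₀) := by
      field_simp
      ring
    rw [h3, abs_div, abs_of_pos (mul_pos hDpos hD₀), div_le_div_iff₀ (by positivity) hD₀]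
    have h4 : |(E - E₀) * D₀ - E₀ * (D - D₀)| ≤ 8 * d * D₀ := by
      refine (abs_sub _ _).trans ?_
      rw [abs_mul, abs_mul, abs_of_pos hD₀, abs_of_pos hE₀]
      nlinarith [mul_le_mul_of_nonneg_right h1 hD₀.le, mul_le_mul hED h2 (abs_nonneg _) hD₀.le]
    nlinarith [mul_le_mul_of_nonneg_right h4 hD₀.le, mul_nonneg (mul_nonneg hd0 hD₀.le)
      (sub_nonneg.2 hD)]
  have h5 : |x - r| * r ≤ |x ^ 2 - r ^ 2| := by
    rw [show x ^ 2 - r ^ 2 = (x - r) * (x + r) by ring, abs_mul]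
    exact mul_le_mul_of_nonneg_left ((by linarith : r ≤ x + r).trans (le_abs_self _))
      (abs_nonneg _)
  rw [← div_div, le_div_iff₀ hr]
  exact h5.trans hxr

variable {F K N : ℕ} {u : Fin K → EuclideanSpace ℝ (Fin F)} {α lam : Fin K → ℝ}

theorem sum_coneIndices_eq (h : ConesSeparated u α) {v : Fin N → EuclideanSpace ℝ (Fin F)}
    (hv : ∀ n, ∃ k, v n ∈ circularCone (u k) (α k)) (g : Fin N → ℝ) :
    ∑ k, ∑ n ∈ coneIndices u α v k, g n = ∑ n, g n := by
  classical
  choose lab hlab using hv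
  have h1 : ∀ k, coneIndices u α v k = cluster lab k := by
    intro k
    ext n
    simp only [coneIndices, cluster, Finset.mem_filter, Finset.mem_univ, true_and]
    refine ⟨fun hn => ?_, fun hn => hn ▸ hlab n⟩
    by_contra hne
    exact Set.disjoint_left.1 (h.disjoint hne) (hlab n) hn
  simp only [h1]
  exact sum_cluster lab g

theorem GoodSample.abs_cluster_error_sub_le (hu : ∀ k, ‖u k‖ = 1)
    (hα : ∀ k, α k ∈ Set.Ioo 0 (Real.pi / 2)) (hlam : ∀ k, 0 < lam k)
    {v : Fin N → EuclideanSpace ℝ (Fin F)} {η : ℝ} (hv : GoodSample u α lam v η) (k : Fin K)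
    {S : ℝ} (hS : ∑ n ∈ coneIndices u α v k, ⟪v n, u k⟫ ^ 2 ≤ S)
    {w : EuclideanSpace ℝ (Fin F)} (hw : ‖w‖ = 1)
    (hSw : S ≤ ∑ n ∈ coneIndices u α v k, ⟪v n, w⟫ ^ 2) :
    |∑ n ∈ coneIndices u α v k, ‖v n‖ ^ 2 - S - N * (fAngle (α k) / lam k / K)| ≤
      7 * (N * η) := by
  have hη : 0 ≤ N * η := (abs_nonneg _).trans (hv.abs_sum_norm_sq_sub_le k)
  obtain ⟨h1, h2⟩ := abs_le.1 (hv.abs_sum_inner_sq_sub_le k)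
  obtain ⟨h3, h4⟩ := abs_le.1 (hv.abs_sum_norm_sq_sub_le k)
  have hsplit : N * (1 / lam k / K) =
      N * ((1 - fAngle (α k)) / lam k / K) + N * (fAngle (α k) / lam k / K) := by ring
  have hf : N * (fAngle (α k) / lam k / K) ≤ N * ((1 - fAngle (α k)) / lam k / K) := by
    have := fAngle_lt_half (hα k).1 (hα k).2
    have := (hlam k).le
    gcongr
    linarith
  -- The complementary block is a difference of two sums, so it deviates by at most `2 * (N * η)`,
  -- and its mean is below that of the axis; hence this `M`. The coupling adds at most `4 * (N *
  -- η)`, so `S` exceeds the axis mean by at most `6 * (N * η)`; the total norm contributes the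
  -- seventh.
  have hb := sum_inner_sq_le (coneIndices u α v k) v (hu k) hw
    (M := N * ((1 - fAngle (α k)) / lam k / K) + 2 * (N * η)) (by linarith) (by linarith)
  have hp := hv.norm_sum_le k
  rw [abs_le]
  constructor <;> linarith

theorem limitError_pos (hK : 1 ≤ K) (hα : ∀ k, α k ∈ Set.Ioo 0 (Real.pi / 2))
    (hlam : ∀ k, 0 < lam k) : 0 < limitError α lam := by
  have : Nonempty (Fin K) := ⟨⟨0, hK⟩⟩
  refine Real.sqrt_pos.2 (div_pos ?_ ?_)
  · exact Finset.sum_pos (fun k _ => div_pos (fAngle_pos (hα k).1) (hlam k)) Finset.univ_nonempty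
  · exact Finset.sum_pos (fun k _ => one_div_pos.2 (hlam k)) Finset.univ_nonempty

/-- Bounding `η` by half the expected mass of each cone forces every cone to contain a column and
keeps `‖V‖²` above half its mean. The constant is `16 d / (D₀ r)` with `d = K N η` and `D₀ = N ∑
1/λ_k / K`. -/
theorem GoodSample.cr1NMFErrorWithin (hK : 1 ≤ K) (hN : 1 ≤ N) (hF : 0 < F)
    (hα : ∀ k, α k ∈ Set.Ioo 0 (Real.pi / 2)) (hlam : ∀ k, 0 < lam k) (h : ConesSeparated u α)
    (hcone : ∀ k, circularCone (u k) (α k) ⊆ nonnegOrthant F)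
    {v : Fin N → EuclideanSpace ℝ (Fin F)} {η : ℝ} (hv : GoodSample u α lam v η)
    (hη : ∀ k, η ≤ 1 / lam k / K / 2) :
    Cr1NMFErrorWithin K (dataMatrix v) (limitError α lam)
      (16 * K ^ 2 / ((∑ k, 1 / lam k) * limitError α lam) * η) := by
  refine ⟨exists_isCr1NMF hK hN _, fun W H hWH => ⟨hWH.nonneg.1, hWH.nonneg.2, ?_⟩⟩
  have hne' : Nonempty (Fin K) := ⟨⟨0, hK⟩⟩
  have hN0 : (0 : ℝ) < N := by exact_mod_cast hN
  have hK0 : (0 : ℝ) < K := by exact_mod_cast hK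
  have hL : 0 < ∑ k, 1 / lam k :=
    Finset.sum_pos (fun k _ => one_div_pos.2 (hlam k)) Finset.univ_nonempty
  have hne : ∀ k, (coneIndices u α v k).Nonempty := by
    intro k
    by_contra hemp
    have h1 := (abs_le.1 (hv.abs_sum_norm_sq_sub_le k)).1
    rw [Finset.not_nonempty_iff_eq_empty.1 hemp, Finset.sum_empty] at h1
    have h2 := mul_le_mul_of_nonneg_left (hη k) hN0.le
    have h3 : 0 < N * (1 / lam k / K) := by have := hlam k; positivity
    linarith
  have hnn : ∀ n i, 0 ≤ v n i := fun n i => by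
    obtain ⟨k, hk⟩ := hv.exists_mem n
    exact hcone k hk i
  obtain ⟨cl, hcl, hS⟩ := hWH.exists_sum_error_eq hF hnn
  obtain ⟨σ, hσ⟩ := h.exists_perm_cluster_eq hv.exists_mem (fun k => by
    obtain ⟨n, hn⟩ := hne k
    exact ⟨n, by simpa [coneIndices] using hn⟩) hcl
  obtain ⟨S, hSeq, hSb⟩ := hS fun k => by
    rw [← σ.apply_symm_apply k, hσ]
    exact hne _
  have hE : |∑ i, ∑ n, (dataMatrix v i n - (W * H) i n) ^ 2 -
      N * ∑ k, fAngle (α k) / lam k / K| ≤ 7 * (K * (N * η)) := by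
    rw [hSeq, ← Equiv.sum_comp σ, Finset.mul_sum, ← Finset.sum_sub_distrib]
    refine (Finset.abs_sum_le_sum_abs _ _).trans ?_
    have h1 : ∀ k ∈ Finset.univ, |∑ n ∈ cluster cl (σ k), ‖v n‖ ^ 2 - S (σ k) -
        N * (fAngle (α k) / lam k / K)| ≤ 7 * (N * η) := by
      intro k _
      obtain ⟨h2, w, hw, h3⟩ := hSb (σ k)
      rw [hσ] at h2 h3 ⊢
      exact hv.abs_cluster_error_sub_le h.norm_eq hα hlam k (h2 _ (h.norm_eq k)) hw h3
    refine (Finset.sum_le_card_nsmul _ _ _ h1).trans (le_of_eq ?_)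
    rw [Finset.card_univ, Fintype.card_fin, nsmul_eq_mul]
    ring
  have hV : ∑ i, ∑ n, dataMatrix v i n ^ 2 = ∑ n, ‖v n‖ ^ 2 := by
    rw [Finset.sum_comm]
    exact Finset.sum_congr rfl fun n _ => (norm_sq_eq_sum_sq _).symm
  have hD : |∑ i, ∑ n, dataMatrix v i n ^ 2 - N * ∑ k, 1 / lam k / K| ≤ K * (N * η) := by
    rw [hV, ← sum_coneIndices_eq h hv.exists_mem, Finset.mul_sum, ← Finset.sum_sub_distrib]
    refine (Finset.abs_sum_le_sum_abs _ _).trans ?_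
    refine (Finset.sum_le_card_nsmul _ _ _ fun k _ => hv.abs_sum_norm_sq_sub_le k).trans
      (le_of_eq ?_)
    rw [Finset.card_univ, Fintype.card_fin, nsmul_eq_mul]
  have hpos : 0 < N * ∑ k, fAngle (α k) / lam k / K :=
    mul_pos hN0 (Finset.sum_pos (fun k _ =>
      div_pos (div_pos (fAngle_pos (hα k).1) (hlam k)) hK0) Finset.univ_nonempty)
  have hle : N * ∑ k, fAngle (α k) / lam k / K ≤ N * ∑ k, 1 / lam k / K := by
    refine mul_le_mul_of_nonneg_left (Finset.sum_le_sum fun k _ => ?_) hN0.le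
    have := fAngle_lt_half (hα k).1 (hα k).2
    have := (hlam k).le
    gcongr
    linarith
  have hd : K * (N * η) ≤ (N * ∑ k, 1 / lam k / K) / 2 := by
    have h1 := Finset.card_nsmul_le_sum Finset.univ _ _ fun k _ => hη k
    rw [Finset.card_univ, Fintype.card_fin, nsmul_eq_mul, ← Finset.sum_div] at h1
    nlinarith
  have hlim : √((N * ∑ k, fAngle (α k) / lam k / K) / (N * ∑ k, 1 / lam k / K)) =
      limitError α lam := by
    rw [limitError, mul_div_mul_left _ _ hN0.ne', ← Finset.sum_div, ← Finset.sum_div,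
      div_div_div_cancel_right₀ hK0.ne']
  have hfin := abs_sqrt_div_sqrt_sub_le (by positivity) hpos hle hE hD hd
  rw [hlim] at hfin
  rw [relativeError_eq]
  refine hfin.trans (le_of_eq ?_)
  have hr := limitError_pos hK hα hlam
  rw [← Finset.sum_div]
  field_simp

end Deterministic

/-! ### The main theorem -/

section Main

variable {K : ℕ} {α lam : Fin K → ℝ}

theorem Cr1NMFErrorWithin.mono {F N : ℕ} {V : Matrix (Fin F) (Fin N) ℝ} {r δ δ' : ℝ}
    (h : Cr1NMFErrorWithin K V r δ) (hδ : δ ≤ δ') : Cr1NMFErrorWithin K V r δ' :=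
  ⟨h.1, fun W H hWH => ⟨(h.2 W H hWH).1, (h.2 W H hWH).2.1, (h.2 W H hWH).2.2.trans hδ⟩⟩

/-- From `5 ≤ exp 2`, the size of the net costs at most `exp (2 F)`, which uses up two of the three
multiples of `t ^ 2 * F`. -/
theorem four_add_five_pow_mul_exp_le {F : ℕ} {t x : ℝ} (ht : 1 ≤ t) (hx : 3 * (t ^ 2 * F) ≤ x) :
    (4 + 5 ^ F) * Real.exp (-x) ≤ 6 * Real.exp (-(t ^ 2 * F)) := by
  have h1 : (5 : ℝ) ^ F ≤ Real.exp (2 * F) := by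
    rw [mul_comm, Real.exp_nat_mul]
    refine pow_le_pow_left₀ (by norm_num) ?_ F
    have h2 := Real.quadratic_le_exp_of_nonneg (x := 2) (by norm_num)
    linarith
  have h3 : (1 : ℝ) ≤ 5 ^ F := one_le_pow₀ (by norm_num)
  have h4 : 2 * (F : ℝ) ≤ 2 * (t ^ 2 * F) := by
    have := le_mul_of_one_le_left (F.cast_nonneg : (0 : ℝ) ≤ F) (one_le_pow₀ ht : 1 ≤ t ^ 2)
    linarith
  calc (4 + 5 ^ F) * Real.exp (-x) ≤ (6 * Real.exp (2 * F)) * Real.exp (-x) := by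
        gcongr
        linarith
    _ = 6 * Real.exp (2 * F - x) := by rw [mul_assoc, ← Real.exp_add]; ring_nf
    _ ≤ 6 * Real.exp (-(t ^ 2 * F)) := by
        gcongr
        linarith

theorem exists_concentration_constant (hK : 1 ≤ K) (hα : ∀ k, α k ∈ Set.Ioo 0 (Real.pi / 2))
    (hlam : ∀ k, 0 < lam k) :
    ∃ c : ℝ, 0 < c ∧ ∀ (F : ℕ), 2 ≤ F → ∀ (u : Fin K → EuclideanSpace ℝ (Fin F)),
      (∀ k, ‖u k‖ = 1) → GeometricAssumption u α →
      (∀ k, circularCone (u k) (α k) ⊆ nonnegOrthant F) →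
      ∀ (ε t : ℝ) (N : ℕ), 0 < ε → ε < 1 → 1 ≤ t → c * (t / ε) ^ 2 * F ≤ N →
        ∃ G : Set (Fin N → EuclideanSpace ℝ (Fin F)), MeasurableSet G ∧
          ENNReal.ofReal (1 - 6 * K * Real.exp (-(t ^ 2 * F))) ≤ dataLaw N u α lam G ∧
          ∀ v ∈ G, Cr1NMFErrorWithin K (dataMatrix v) (limitError α lam) (c * ε) := by
  obtain ⟨C, hC, hgood⟩ := exists_goodSample (α := α) hlam hK
  have hK1 : (1 : ℝ) ≤ K := by exact_mod_cast hK
  have hK0 : (0 : ℝ) < K := by linarith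
  have hΛ0 : 0 ≤ ∑ k, lam k := Finset.sum_nonneg fun k _ => (hlam k).le
  -- The tolerance will be `η = κ * ε`. Using the sum of the rates plus one puts `κ` below `1` and
  -- below half the expected mass of every cone simultaneously.
  set κ : ℝ := 1 / (∑ k, lam k + 1) / K / 2 with hκ
  have hκ0 : 0 < κ := by positivity
  have hκ1 : κ ≤ 1 := by
    rw [hκ, div_div, div_div, div_le_one (by positivity)]
    nlinarith
  have hκk : ∀ k, κ ≤ 1 / lam k / K / 2 := by
    intro k
    have h1 := Finset.single_le_sum (fun i _ => (hlam i).le) (Finset.mem_univ k)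
    have h2 := hlam k
    rw [hκ]
    gcongr
    linarith
  set B : ℝ := 16 * K ^ 2 / ((∑ k, 1 / lam k) * limitError α lam) with hB
  have hB0 : 0 ≤ B := by
    have h1 := limitError_pos hK hα hlam
    have h2 : 0 ≤ ∑ k, 1 / lam k := Finset.sum_nonneg fun k _ => (one_div_pos.2 (hlam k)).le
    positivity
  -- The first summand bounds the error `B * κ * ε`; the second makes `N * η ^ 2 / (4 * C) ≥ 3 * t ^
  -- 2 * F`.
  refine ⟨B * κ + 12 * C / κ ^ 2, by positivity, ?_⟩
  intro F hF u hu hgeom hcone ε t N hε hε1 ht hN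
  have hsep : ConesSeparated u α := ⟨hu, fun k => (hα k).1, fun k => (hα k).2, hgeom⟩
  have hdata : ∀ k, ConeData F (u k) (α k) (lam k) := fun k =>
    ⟨hF, hu k, (hα k).1, (hα k).2, hlam k, hcone k⟩
  have hF0 : (0 : ℝ) < F := by exact_mod_cast (by omega : 0 < F)
  have ht0 : 0 < t := by linarith
  have hN0 : 1 ≤ N := by
    have : (0 : ℝ) < N := lt_of_lt_of_le (by positivity) hN
    exact_mod_cast this
  obtain ⟨G, hGm, hGP, hG⟩ := hgood F u hdata hsep.disjoint N (κ * ε) (by positivity)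
    (by nlinarith)
  refine ⟨G, hGm, le_trans (ENNReal.ofReal_le_ofReal ?_) hGP, fun v hv => ?_⟩
  · have h1 : 3 * (t ^ 2 * F) ≤ N * (κ * ε) ^ 2 / (4 * C) := by
      rw [le_div_iff₀ (by positivity)]
      have h2 : 12 * C / κ ^ 2 * (t / ε) ^ 2 * F ≤ N := by
        refine le_trans ?_ hN
        gcongr
        linarith [mul_nonneg hB0 hκ0.le]
      have h3 := mul_le_mul_of_nonneg_right h2 (sq_nonneg (κ * ε))
      have h4 : 12 * C / κ ^ 2 * (t / ε) ^ 2 * F * (κ * ε) ^ 2 = 3 * (t ^ 2 * F) * (4 * C) := by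
        field_simp
        ring
      rwa [h4] at h3
    have h5 := mul_le_mul_of_nonneg_left (four_add_five_pow_mul_exp_le ht h1) hK0.le
    linarith
  · refine ((hG v hv).cr1NMFErrorWithin hK hN0 (by omega) hα hlam hsep hcone
      fun k => le_trans (by nlinarith) (hκk k)).mono ?_
    rw [← hB, ← mul_assoc]
    gcongr
    linarith [show 0 ≤ 12 * C / κ ^ 2 by positivity]

theorem tendsto_measure_not_errorWithin {F : ℕ} (hF : 0 < F)
    {u : Fin K → EuclideanSpace ℝ (Fin F)} [IsProbabilityMeasure (columnLaw u α lam)] {c r : ℝ}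
    (hc : 0 < c)
    (h : ∀ (ε t : ℝ) (N : ℕ), 0 < ε → ε < 1 → 1 ≤ t → c * (t / ε) ^ 2 * F ≤ N →
      ∃ G : Set (Fin N → EuclideanSpace ℝ (Fin F)), MeasurableSet G ∧
        ENNReal.ofReal (1 - 6 * K * Real.exp (-(t ^ 2 * F))) ≤ dataLaw N u α lam G ∧
        ∀ v ∈ G, Cr1NMFErrorWithin K (dataMatrix v) r (c * ε)) {δ : ℝ} (hδ : 0 < δ) :
    Tendsto (fun N : ℕ => dataLaw N u α lam
      {v | ¬ Cr1NMFErrorWithin K (dataMatrix v) r δ}) atTop (𝓝 0) := by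
  have hF0 : (0 : ℝ) < F := by exact_mod_cast hF
  obtain ⟨ε, hε, hε1, hεδ⟩ : ∃ ε : ℝ, 0 < ε ∧ ε < 1 ∧ c * ε ≤ δ := by
    refine ⟨min (1 / 2) (δ / c), by positivity, (min_le_left _ _).trans_lt (by norm_num), ?_⟩
    calc c * min (1 / 2) (δ / c) ≤ c * (δ / c) :=
          mul_le_mul_of_nonneg_left (min_le_right _ _) hc.le
      _ = δ := by field_simp
  have hlim : Tendsto (fun N : ℕ => ENNReal.ofReal (6 * K * Real.exp (-(ε ^ 2 / c * N))))
      atTop (𝓝 0) := by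
    rw [← ENNReal.ofReal_zero]
    refine ENNReal.tendsto_ofReal ?_
    rw [← mul_zero (6 * K : ℝ)]
    refine Tendsto.const_mul _ (Real.tendsto_exp_neg_atTop_nhds_zero.comp ?_)
    exact tendsto_natCast_atTop_atTop.const_mul_atTop (by positivity)
  refine tendsto_of_tendsto_of_tendsto_of_le_of_le' tendsto_const_nhds hlim
    (Eventually.of_forall fun _ => zero_le) ?_
  filter_upwards [eventually_ge_atTop ⌈c * F / ε ^ 2⌉₊] with N hN
  have hN' : c * F / ε ^ 2 ≤ N := Nat.ceil_le.1 hN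
  have ht2 : √(ε ^ 2 * N / (c * F)) ^ 2 = ε ^ 2 * N / (c * F) := Real.sq_sqrt (by positivity)
  -- With `ε` fixed, `t` is the largest value allowed by `N`, turning `c * (t / ε) ^ 2 * F ≤ N` into
  -- an equality; the failure bound becomes `6 * K * exp (-(ε ^ 2 / c * N))`.
  obtain ⟨G, hGm, hGP, hG⟩ := h ε √(ε ^ 2 * N / (c * F)) N hε hε1 (by
    rw [Real.one_le_sqrt, one_le_div (by positivity)]
    rw [div_le_iff₀ (by positivity)] at hN'
    linarith) (by
    rw [div_pow, ht2]
    refine le_of_eq ?_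
    field_simp)
  have hexp : √(ε ^ 2 * N / (c * F)) ^ 2 * F = ε ^ 2 / c * N := by
    rw [ht2]
    field_simp
  rw [hexp] at hGP
  have hprob : IsProbabilityMeasure (dataLaw N u α lam) := by
    unfold dataLaw
    infer_instance
  calc dataLaw N u α lam {v | ¬ Cr1NMFErrorWithin K (dataMatrix v) r δ}
      ≤ dataLaw N u α lam Gᶜ := measure_mono fun v hv hvG => hv ((hG v hvG).mono hεδ)
    _ = 1 - dataLaw N u α lam G := prob_compl_eq_one_sub hGm
    _ ≤ 1 - ENNReal.ofReal (1 - 6 * K * Real.exp (-(ε ^ 2 / c * N))) := by gcongr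
    _ ≤ ENNReal.ofReal (6 * K * Real.exp (-(ε ^ 2 / c * N))) := by
        rw [tsub_le_iff_right, ← ENNReal.ofReal_one]
        refine le_trans (le_of_eq ?_) ENNReal.ofReal_add_le
        ring_nf

end Main

end ConeNMF

end

theorem theorem4 (K : ℕ) (hK : 1 ≤ K) (α lam : Fin K → ℝ)
    (hα : ∀ k, α k ∈ Set.Ioo 0 (Real.pi / 2)) (hlam : ∀ k, 0 < lam k) :
    ∃ c : ℝ, 0 < c ∧
      ∀ (F : ℕ), 2 ≤ F → ∀ (u : Fin K → EuclideanSpace ℝ (Fin F)),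
        (∀ k, ‖u k‖ = 1) → (∀ k, u k ∈ ConeNMF.nonnegOrthant F) →
        ConeNMF.GeometricAssumption u α →
        (∀ k, ConeNMF.circularCone (u k) (α k) ⊆ ConeNMF.nonnegOrthant F) →
        (∀ (ε t : ℝ) (N : ℕ), 0 < ε → ε < 1 → 1 ≤ t → c * (t / ε) ^ 2 * F ≤ N →
          ∃ G : Set (Fin N → EuclideanSpace ℝ (Fin F)), MeasurableSet G ∧
            ENNReal.ofReal (1 - 6 * K * Real.exp (-(t ^ 2 * F))) ≤
              ConeNMF.dataLaw N u α lam G ∧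
            ∀ v ∈ G, ConeNMF.Cr1NMFErrorWithin K (ConeNMF.dataMatrix v)
              (ConeNMF.limitError α lam) (c * ε)) ∧
        (∀ δ : ℝ, 0 < δ →
          Tendsto (fun N : ℕ => ConeNMF.dataLaw N u α lam
            {v | ¬ ConeNMF.Cr1NMFErrorWithin K (ConeNMF.dataMatrix v)
              (ConeNMF.limitError α lam) δ}) atTop (𝓝 0)) := by
  obtain ⟨c, hc, h⟩ := ConeNMF.exists_concentration_constant hK hα hlam
  refine ⟨c, hc, fun F hF u hu _ hgeom hcone => ?_⟩
  have hdata : ∀ k, ConeNMF.ConeData F (u k) (α k) (lam k) := fun k =>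
    ⟨hF, hu k, (hα k).1, (hα k).2, hlam k, hcone k⟩
  have := ConeNMF.isProbabilityMeasure_columnLaw hK hdata
  exact ⟨h F hF u hu hgeom hcone, fun δ hδ =>
    ConeNMF.tendsto_measure_not_errorWithin (by omega) hc (h F hF u hu hgeom hcone) hδ⟩
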